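/- Let $(p_j)_{j\ge 1}$ be the Erdős–Taylor sequence, defined by $p_1=1$ and $p_{j+1}=jp_j+1$ for $j\ge 1$. For every integer $q\ge 0$ let $I_q$ be the set of integers $j$ with $2^q<j\le 2^{q+1}$. Let $0=q_0<q_1<q_2<\cdots$ be any strictly increasing sequence of integers such that $q_{l+1}-q_l\to\infty$ as $l\to\infty$. For $l\ge 0$ set $$J_l=\bigcup_{q_l\le q<q_{l+1}} I_q,\qquad \mathscr S_l=\Bigl\{\sum_{j\in F}p_j\;;\;F\subseteq J_l\Bigr\},\qquad D=\bigcup_{l\ge 0}\mathscr S_l .$$ Then $D$ is an infinite set of non-negative integers, and its increasing enumeration $(n_k)_{k\ge 0}$ is a rigidity sequence which is dense in the Bohr compactification $b\mathbb Z$ of $\mathbb Z$. Here a sequence $(n_k)_{k\ge 0}$ of non-negative integers is called a *rigidity sequence* if there exist a probability space $(X,\mathcal B,m)$ on which some measurable set $A$ satisfies $0<m(A)<1$, and a weakly mixing measure-preserving map $T:X\to X$, such that $m(T^{-n_k}A\,\triangle\,A)\to 0$ as $k\to\infty$ for every $A\in\mathcal B$. The map $T$ is *weakly mixing* if the spectral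 measure of the operator $U_T:f\mapsto f\circ T$ on $L^2_0(m)=\{f\in L^2(m)\,;\,\int_X f\,dm=0\}$ is continuous, i.e. if for every $f\in L^2_0(m)$ the spectral measure of $f$ (the finite Borel measure $\sigma_f$ on $\mathbb T=\{z\in\mathbb C\,;\,|z|=1\}$ with $\int_{\mathbb T} z^n\,d\sigma_f(z)=\langle U_T^n f,f\rangle$ for all $n\ge 0$) has no atoms. The Bohr compactification $b\mathbb Z$ is the group of all (not necessarily continuous) homomorphisms $\chi:\mathbb T\to\mathbb T$ with the topology of pointwise convergence, and $n\in\mathbb Z$ is identified with the homomorphism $z\mapsto z^n$. -/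

import Mathlib

open MeasureTheory Filter Topology

noncomputable section

/-! ### Rigidity sequences -/

/-- The unit circle carries its Borel σ-algebra. -/
instance instMeasurableSpaceCircle : MeasurableSpace Circle := borel Circle

instance instBorelSpaceCircle : BorelSpace Circle := ⟨rfl⟩

/-- `σ` is the spectral measure of `f ∈ L²(m)` for the Koopman operator `U_T g = g ∘ T`:
it is the finite Borel measure on the unit circle such that
`∫ zⁿ dσ(z) = ⟨U_Tⁿ f, f⟩` for all `n ≥ 0` (the coefficients of negative order are the complex
conjugates of these). Such a measure exists and is unique by Herglotz' theorem. -/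
def IsSpectralMeasure {X : Type*} [MeasurableSpace X] (m : Measure X) (T : X → X)
    (f : X → ℂ) (σ : Measure Circle) : Prop :=
  IsFiniteMeasure σ ∧
    ∀ n : ℕ, ∫ z : Circle, (z : ℂ) ^ n ∂σ = ∫ x, f (T^[n] x) * starRingEnd ℂ (f x) ∂m

/-- The measure-preserving system `(X, m, T)` is weakly mixing: the spectral measure of `U_T`
acting on `L²₀(m) = {f ∈ L²(m) : ∫ f dm = 0}` is continuous, that is, the spectral measure of
every `f ∈ L²₀(m)` is atomless. -/
def IsWeaklyMixing {X : Type*} [MeasurableSpace X] (m : Measure X) (T : X → X) : Prop :=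
  ∀ f : X → ℂ, MemLp f 2 m → ∫ x, f x ∂m = 0 →
    ∀ σ : Measure Circle, IsSpectralMeasure m T f σ → ∀ z : Circle, σ {z} = 0

/-- The sequence `n` is rigid for `(X, m, T)`: `m (T^{-n_k} A ∆ A) → 0` for all measurable `A`. -/
def IsRigidFor {X : Type*} [MeasurableSpace X] (m : Measure X) (T : X → X) (n : ℕ → ℕ) : Prop :=
  ∀ A : Set X, MeasurableSet A →
    Tendsto (fun k => m (symmDiff (T^[n k] ⁻¹' A) A)) atTop (𝓝 0)

/-- `n` is a rigidity sequence: it is rigid for some weakly mixing measure-preserving system on a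
nontrivial probability space (on a trivial one, where all measurable sets have measure `0` or `1`,
every map is weakly mixing and every sequence is rigid). -/
def IsRigiditySequence (n : ℕ → ℕ) : Prop :=
  ∃ (X : Type) (_ : MeasurableSpace X) (m : Measure X) (T : X → X),
    IsProbabilityMeasure m ∧ (∃ A : Set X, MeasurableSet A ∧ 0 < m A ∧ m A < 1) ∧
      MeasurePreserving T m m ∧ IsWeaklyMixing m T ∧ IsRigidFor m T n

/-! ### The Bohr compactification of the integers -/

/-- The Bohr compactification `bℤ`: the group of all homomorphisms `χ : 𝕋 → 𝕋`, continuous or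
not. -/
def BohrZ : Type := Circle →* Circle

/-- The topology of pointwise convergence on `bℤ`. -/
instance instTopologicalSpaceBohrZ : TopologicalSpace BohrZ :=
  TopologicalSpace.induced (fun (χ : Circle →* Circle) (z : Circle) => χ z) inferInstance

/-- The embedding of `ℤ` in `bℤ`, which sends `n` to the homomorphism `z ↦ zⁿ`. -/
def BohrZ.ofInt (n : ℤ) : BohrZ := (zpowGroupHom n : Circle →* Circle)

/-- A set of integers is dense in `bℤ`. -/
def IsBohrDense (D : Set ℤ) : Prop := Dense (BohrZ.ofInt '' D)

/-! ### The Erdős–Taylor sequence and the sets of finite sums -/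

/-- The Erdős–Taylor sequence `p₁ = 1`, `p_{j+1} = j p_j + 1` for `j ≥ 1`. The additional value
`p₀ = 0` makes the recursion valid from `j = 0` on and is never used. -/
def erdosTaylor : ℕ → ℕ
  | 0 => 0
  | j + 1 => j * erdosTaylor j + 1

/-- The dyadic interval `I_i = (2^i, 2^{i+1}]` of integers. -/
def dyadicBlock (i : ℕ) : Finset ℕ := Finset.Ioc (2 ^ i) (2 ^ (i + 1))

/-- `J_l`, the union of the `I_i` with `q_l ≤ i < q_{l+1}`. -/
def blockUnion (q : ℕ → ℕ) (l : ℕ) : Finset ℕ :=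
  (Finset.Ico (q l) (q (l + 1))).biUnion dyadicBlock

/-- The set of sums `∑_{j ∈ F} p_j` with `F ⊆ J`. -/
def subsetSums (J : Finset ℕ) : Set ℕ := {s | ∃ F ⊆ J, s = ∑ j ∈ F, erdosTaylor j}

/-- `D`, the union over all `l` of the sets of subset sums over `J_l`. -/
def erdosTaylorSums (q : ℕ → ℕ) : Set ℕ := ⋃ l, subsetSums (blockUnion q l)

end

noncomputable section

/-! Rigidity follows from a continuous probability measure σ on the circle with z ^ n_k → 1 in
L²(σ). The shift on the infinite torus, with the law of the exponential of a stationary Gaussian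
process of spectral measure σ, is weakly mixing because σ has no atoms (Wiener's lemma), and it
inherits the rigidity of σ (`isRigiditySequence_of_circle_measure`).

The measure comes from p_{j+1} = j! · (1 + 1/1! + … + 1/j!). Put L = 1 + ∑ d_n / (n+2)! with digits
0 or 1, T_n its partial sums and θ = L / e. Modulo 1, θ p_{n+2} equals (d_n - T_n / e) / (n+2) up to
O(1/n²) (`abs_residue_sub_le`). Choose the digits at random, with d_n = 1 of conditional probability
T_n / e: the main terms become orthogonal martingale differences with square-summable norms. So z ^
s is close to 1 in L² for every sum s of p_j with all j > M, at a rate depending on M alone and not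
on the number of terms (`integral_pow_sum_erdosTaylor_sub_one_sq_le`).

In the other direction, p_{j+1} = j p_j + 1 prevents all the z ^ p_j of a dyadic block from being
too close to 1: each block contains a set G whose sum s satisfies |z ^ s - 1| ≥ |z - 1| / 40
(`exists_subset_dyadicBlock`). This has two uses. An atom of σ at z ≠ 1 would contradict the L²
convergence, so σ is continuous (`erdosTaylorMeasure_singleton`). And if one such sum w_i is
selected in each of many consecutive blocks, the average of z ^ s over all subset sums s of the w_i
is ∏ (1 + z ^ w_i) / 2, which is small; sharing the blocks among finitely many z ≠ 1 makes all these
averages small at once (`exists_family_average_small`). Testing such a family against a polynomial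
peaked where z_i ^ n = χ(z_i) for all i yields an n in D that approximates χ
(`exists_mem_erdosTaylorSums_near`). -/

/-! ### Characters of the infinite torus -/

/-- The character `x ↦ ∏ x_n ^ {a_n}` of the infinite torus `𝕋^ℕ`. -/
def torusChar (a : ℕ →₀ ℤ) (x : ℕ → Circle) : Circle := a.prod fun n k => x n ^ k

lemma torusChar_zero (x : ℕ → Circle) : torusChar 0 x = 1 := by simp [torusChar]

lemma torusChar_single (n : ℕ) (x : ℕ → Circle) : torusChar (Finsupp.single n 1) x = x n := by
  simp [torusChar]

lemma torusChar_add (a b : ℕ →₀ ℤ) (x : ℕ → Circle) :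
    torusChar (a + b) x = torusChar a x * torusChar b x :=
  Finsupp.prod_add_index' (by simp) (fun _ _ _ => zpow_add _ _ _)

lemma torusChar_neg (a : ℕ →₀ ℤ) (x : ℕ → Circle) : torusChar (-a) x = (torusChar a x)⁻¹ := by
  rw [eq_inv_iff_mul_eq_one, ← torusChar_add, neg_add_cancel, torusChar_zero]

lemma torusChar_sub (a b : ℕ →₀ ℤ) (x : ℕ → Circle) :
    (torusChar (a - b) x : ℂ) = torusChar a x * starRingEnd ℂ (torusChar b x) := by
  rw [sub_eq_add_neg, torusChar_add, torusChar_neg, Circle.coe_mul, Circle.coe_inv_eq_conj]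

lemma continuous_torusChar (a : ℕ →₀ ℤ) : Continuous (torusChar a) :=
  continuous_finsetProd _ fun n _ => (continuous_apply n).zpow _

/-- The character `torusChar a` as a complex-valued continuous function. -/
def torusCharC (a : ℕ →₀ ℤ) : C(ℕ → Circle, ℂ) :=
  ⟨fun x => (torusChar a x : ℂ), continuous_subtype_val.comp (continuous_torusChar a)⟩

@[simp] lemma torusCharC_apply (a : ℕ →₀ ℤ) (x : ℕ → Circle) :
    torusCharC a x = (torusChar a x : ℂ) := rfl

/-- The star subalgebra of trigonometric polynomials on the infinite torus. -/
def torusSubalgebra : StarSubalgebra ℂ C(ℕ → Circle, ℂ) where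
  toSubalgebra := Algebra.adjoin ℂ (Set.range torusCharC)
  star_mem' := by
    change Algebra.adjoin ℂ (Set.range torusCharC) ≤
      star (Algebra.adjoin ℂ (Set.range torusCharC))
    refine Algebra.adjoin_le ?_
    rintro - ⟨a, rfl⟩
    refine Algebra.subset_adjoin ⟨-a, ?_⟩
    ext x
    simp [torusChar_neg, ← Circle.coe_inv_eq_conj]

lemma torusSubalgebra_coe : torusSubalgebra.toSubalgebra.toSubmodule =
    Submodule.span ℂ (Set.range torusCharC) := by
  refine Algebra.adjoin_eq_span_of_subset _ (Set.Subset.trans ?_ Submodule.subset_span)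
  intro x hx
  refine Submonoid.closure_induction (fun _ => id)
    ⟨0, by ext; simp [torusChar_zero]⟩ ?_ hx
  rintro - - - - ⟨a, rfl⟩ ⟨b, rfl⟩
  exact ⟨a + b, by ext; simp [torusChar_add]⟩

lemma span_torusCharC_closure_eq_top :
    (Submodule.span ℂ (Set.range torusCharC)).topologicalClosure = ⊤ := by
  rw [← torusSubalgebra_coe]
  refine congr_arg (Subalgebra.toSubmodule <| StarSubalgebra.toSubalgebra ·)
    (ContinuousMap.starSubalgebra_topologicalClosure_eq_top_of_separatesPoints
      torusSubalgebra ?_)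
  intro x y hxy
  obtain ⟨n, hn⟩ := Function.ne_iff.mp hxy
  refine ⟨_, ⟨torusCharC (Finsupp.single n 1), Algebra.subset_adjoin ⟨_, rfl⟩, rfl⟩, ?_⟩
  simpa [torusChar_single, Circle.ext_iff] using hn

lemma exists_torus_polynomial_Lp_near (m : Measure (ℕ → Circle)) [IsFiniteMeasure m]
    (f : Lp ℂ 2 m) {ε : ℝ} (hε : 0 < ε) :
    ∃ c : (ℕ →₀ ℤ) →₀ ℂ,
      ‖f - ContinuousMap.toLp 2 m ℂ (c.sum fun a r => r • torusCharC a)‖ < ε := by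
  have h := (ContinuousMap.toLp_denseRange ℂ m ℂ (p := 2) (by simp)).topologicalClosure_map_submodule
      span_torusCharC_closure_eq_top
  have hf : f ∈ closure ((Submodule.span ℂ (Set.range torusCharC)).map
      (ContinuousMap.toLp 2 m ℂ : C(ℕ → Circle, ℂ) →L[ℂ] Lp ℂ 2 m).toLinearMap : Set (Lp ℂ 2 m)) := by
    rw [← Submodule.topologicalClosure_coe]
    exact h ▸ Submodule.mem_top
  obtain ⟨-, ⟨g, hg, rfl⟩, hfg⟩ := Metric.mem_closure_iff.mp hf ε hε
  obtain ⟨c, rfl⟩ := Finsupp.mem_span_range_iff_exists_finsupp.mp hg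
  exact ⟨c, by rw [← dist_eq_norm]; exact hfg⟩

instance : PolishSpace Circle := inferInstanceAs (PolishSpace (Metric.sphere (0 : ℂ) 1))

/-- A finite measure on the infinite torus is determined by its Fourier coefficients. -/
lemma ext_of_integral_torusChar {m m' : Measure (ℕ → Circle)} [IsFiniteMeasure m]
    [IsFiniteMeasure m'] (h : ∀ a, ∫ x, (torusChar a x : ℂ) ∂m = ∫ x, (torusChar a x : ℂ) ∂m') :
    m = m' := by
  let e := BoundedContinuousFunction.mkOfCompact (α := ℕ → Circle) (β := ℂ)
  have hint : ∀ (μ : Measure (ℕ → Circle)) [IsFiniteMeasure μ] (f : C(ℕ → Circle, ℂ)),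
      Integrable f μ := fun μ _ f => (e f).integrable μ
  have hpoly : ∀ f ∈ Submodule.span ℂ (Set.range torusCharC), ∫ x, f x ∂m = ∫ x, f x ∂m' := by
    intro f hf
    induction hf using Submodule.span_induction with
    | mem f hf => obtain ⟨a, rfl⟩ := hf; exact h a
    | zero => simp
    | add f g hf hg h1 h2 =>
      simp only [ContinuousMap.add_apply]
      rw [integral_add (hint m f) (hint m g), integral_add (hint m' f) (hint m' g), h1, h2]
    | smul r f hf h1 =>
      simp only [ContinuousMap.smul_apply]
      rw [integral_smul, integral_smul, h1]
  refine ext_of_forall_mem_subalgebra_integral_eq_of_polish (𝕜 := ℂ)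
    (A := torusSubalgebra.comap (BoundedContinuousFunction.toContinuousMapStarₐ ℂ)) ?_ ?_
  · intro x y hxy
    obtain ⟨n, hn⟩ := Function.ne_iff.mp hxy
    refine ⟨_, ⟨torusCharC (Finsupp.single n 1), ⟨e (torusCharC (Finsupp.single n 1)), ?_, rfl⟩,
      rfl⟩, ?_⟩
    · exact Algebra.subset_adjoin ⟨Finsupp.single n 1, rfl⟩
    · simpa [torusChar_single, Circle.ext_iff] using hn
  · intro g hg
    exact hpoly (g.toContinuousMap) (torusSubalgebra_coe ▸ hg)

/-! ### Gaussian measures on the infinite torus -/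

section Gaussian

open ProbabilityTheory InnerProductSpace

variable {E : Type*} [NormedAddCommGroup E] [InnerProductSpace ℝ E]

/-- The coefficients of a sequence of vectors with respect to its Gram–Schmidt orthonormalization. -/
def gramSchmidtCoeff (v : ℕ → E) (n k : ℕ) : ℝ := inner ℝ (gramSchmidtNormed ℝ v k) (v n)

lemma gramSchmidtCoeff_eq_zero (v : ℕ → E) {n k : ℕ} (h : n < k) : gramSchmidtCoeff v n k = 0 := by
  rw [gramSchmidtCoeff, gramSchmidtNormed, inner_smul_left, gramSchmidt_inv_triangular ℝ v h,
    mul_zero]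

/-- The vectors may be linearly dependent, so some normalized vectors may vanish; their terms then
contribute nothing on either side. -/
lemma sum_gramSchmidtCoeff_smul (v : ℕ → E) {n K : ℕ} (h : n < K) :
    ∑ k ∈ Finset.range K, gramSchmidtCoeff v n k • gramSchmidtNormed ℝ v k = v n := by
  have h1 : ∑ k ∈ Finset.range K, gramSchmidtCoeff v n k • gramSchmidtNormed ℝ v k =
      ∑ k ∈ Finset.range (n + 1), gramSchmidtCoeff v n k • gramSchmidtNormed ℝ v k := by
    refine (Finset.sum_subset (Finset.range_subset_range.2 h) fun k _ hk => ?_).symm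
    rw [gramSchmidtCoeff_eq_zero v (by simpa using hk), zero_smul]
  have key : ∀ k x, inner ℝ (gramSchmidtNormed ℝ v k) x • gramSchmidtNormed ℝ v k =
      (inner ℝ (gramSchmidt ℝ v k) x / ‖gramSchmidt ℝ v k‖ ^ 2) • gramSchmidt ℝ v k := by
    intro k x
    rw [gramSchmidtNormed, inner_smul_left, smul_smul]
    congr 1
    simp
    ring
  rw [h1, Finset.sum_range_succ]
  conv_rhs => rw [gramSchmidt_def'' ℝ v n]
  rw [add_comm]
  simp only [gramSchmidtCoeff, key]
  congr 1
  · have : inner ℝ (gramSchmidt ℝ v n) (v n) = ‖gramSchmidt ℝ v n‖ ^ 2 := by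
      conv_lhs => rw [gramSchmidt_def'' ℝ v n]
      rw [inner_add_right, inner_sum, Finset.sum_eq_zero, add_zero, real_inner_self_eq_norm_sq]
      intro k hk
      rw [inner_smul_right, gramSchmidt_orthogonal ℝ v (Finset.mem_Iio.1 hk).ne', mul_zero]
    rw [this]
    by_cases h0 : gramSchmidt ℝ v n = 0
    · simp [h0]
    · rw [div_self (by simpa using h0), one_smul]
  · rw [← Nat.Iio_eq_range]
    rfl

/-- Parseval's identity for a family that is orthonormal only up to zero vectors: the expansion
holds on the generators, hence on their span. -/
lemma norm_sq_eq_sum_inner_gramSchmidtNormed (v : ℕ → E) {K : ℕ} {w : E}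
    (hw : w ∈ Submodule.span ℝ (v '' Set.Iio K)) :
    ‖w‖ ^ 2 = ∑ k ∈ Finset.range K, inner ℝ (gramSchmidtNormed ℝ v k) w ^ 2 := by
  have h : w = ∑ k ∈ Finset.range K, inner ℝ (gramSchmidtNormed ℝ v k) w •
      gramSchmidtNormed ℝ v k := by
    induction hw using Submodule.span_induction with
    | mem x hx => obtain ⟨n, hn, rfl⟩ := hx; exact (sum_gramSchmidtCoeff_smul v hn).symm
    | zero => simp
    | add x y _ _ hx hy =>
      simp only [inner_add_right, add_smul, Finset.sum_add_distrib]
      rw [← hx, ← hy]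
    | smul r x _ hx =>
      simp only [inner_smul_right, mul_smul, ← Finset.smul_sum]
      rw [← hx]
  rw [← real_inner_self_eq_norm_sq]
  nth_rw 2 [h]
  rw [inner_sum]
  refine Finset.sum_congr rfl fun k _ => ?_
  rw [inner_smul_right, real_inner_comm, sq]

/-- The product of countably many standard Gaussian measures. -/
def stdGaussianSeq : Measure (ℕ → ℝ) := Measure.infinitePi fun _ => gaussianReal 0 1

instance : IsProbabilityMeasure stdGaussianSeq := by unfold stdGaussianSeq; infer_instance

lemma integral_exp_sum_stdGaussianSeq (b : ℕ → ℝ) (K : ℕ) :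
    ∫ g, (Circle.exp (∑ k ∈ Finset.range K, b k * g k) : ℂ) ∂stdGaussianSeq =
      Real.exp (-(∑ k ∈ Finset.range K, b k ^ 2) / 2) := by
  have hind : iIndepFun (fun k (g : ℕ → ℝ) => b k * g k) stdGaussianSeq :=
    iIndepFun_infinitePi (X := fun k x => b k * x) (fun k => by fun_prop)
  have h := iIndepFun.charFun_map_fun_finsetSum_eq_prod (s := Finset.range K)
    (X := fun k (g : ℕ → ℝ) => b k * g k) (P := stdGaussianSeq)
    (fun i _ => Measurable.aemeasurable (by fun_prop)) (hind.restrict _)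
  have h2 := congrFun h 1
  rw [charFun_apply_real, integral_map (Measurable.aemeasurable (by fun_prop))
    (by fun_prop)] at h2
  simp only [Circle.coe_exp]
  simp only [Complex.ofReal_one, one_mul] at h2
  rw [h2, Finset.prod_apply]
  have h3 : ∀ k, charFun (stdGaussianSeq.map fun g => b k * g k) 1 =
      Complex.exp (-(b k ^ 2) / 2 : ℝ) := by
    intro k
    have : stdGaussianSeq.map (fun g => b k * g k) = (gaussianReal 0 1).map (fun x => b k * x) := by
      rw [← Measure.infinitePi_map_eval (fun _ : ℕ => gaussianReal 0 1) k,
        Measure.map_map (by fun_prop) (by fun_prop)]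
      rfl
    rw [this, gaussianReal_map_const_mul, charFun_gaussianReal]
    simp
    ring_nf
  simp only [h3]
  rw [← Complex.exp_sum, Complex.ofReal_exp]
  congr 1
  push_cast
  rw [neg_div, Finset.sum_div, ← Finset.sum_neg_distrib]
  simp only [neg_div]

lemma circle_exp_sum {ι : Type*} (s : Finset ι) (f : ι → ℝ) :
    Circle.exp (∑ i ∈ s, f i) = ∏ i ∈ s, Circle.exp (f i) := by
  classical
  induction s using Finset.induction_on with
  | empty => simp
  | insert i s hi ih => rw [Finset.sum_insert hi, Finset.prod_insert hi, Circle.exp_add, ih]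

/-- For every sequence of vectors of a Hilbert space there is a measure on the infinite torus, the
law of the exponential of a Gaussian process, whose Fourier coefficients are given by the norms of integer combinations. -/
theorem exists_gaussian_torus_measure (v : ℕ → E) :
    ∃ m : Measure (ℕ → Circle), IsProbabilityMeasure m ∧ ∀ a : ℕ →₀ ℤ,
      ∫ x, (torusChar a x : ℂ) ∂m = Real.exp (-‖a.sum fun n r => (r : ℝ) • v n‖ ^ 2 / 2) := by
  -- The Gaussian variable attached to `v n` is ∑ ⟨e_k, v n⟩ g_k, with e_k the Gram–Schmidt vectors;
  -- by triangularity the terms with k > n vanish, so the sum is finite.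
  let Y : (ℕ → ℝ) → ℕ → Circle := fun g n =>
    Circle.exp (∑ k ∈ Finset.range (n + 1), gramSchmidtCoeff v n k * g k)
  have hY : Measurable Y := by
    refine measurable_pi_lambda _ fun n => ?_
    exact Circle.exp.continuous.measurable.comp (by fun_prop)
  refine ⟨stdGaussianSeq.map Y, Measure.isProbabilityMeasure_map hY.aemeasurable, fun a => ?_⟩
  refine (integral_map (f := fun x => (torusChar a x : ℂ)) hY.aemeasurable
    (torusCharC a).continuous.aestronglyMeasurable).trans ?_
  obtain ⟨K, hK⟩ : ∃ K, ∀ n ∈ a.support, n < K :=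
    ⟨a.support.sup id + 1, fun n hn => Nat.lt_succ_of_le (Finset.le_sup (f := id) hn)⟩
  set w := a.sum fun n r => (r : ℝ) • v n with hw
  have hwmem : w ∈ Submodule.span ℝ (v '' Set.Iio K) :=
    Submodule.sum_mem _ fun n hn => Submodule.smul_mem _ _
      (Submodule.subset_span ⟨n, hK n hn, rfl⟩)
  rw [norm_sq_eq_sum_inner_gramSchmidtNormed v hwmem, ← integral_exp_sum_stdGaussianSeq]
  refine integral_congr_ae (ae_of_all _ fun g => ?_)
  have h1 : ∀ n ∈ a.support, Y g n =
      Circle.exp (∑ k ∈ Finset.range K, gramSchmidtCoeff v n k * g k) := by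
    intro n hn
    refine congrArg Circle.exp (Finset.sum_subset (Finset.range_subset_range.2 (hK n hn))
      fun k _ hk => ?_)
    rw [gramSchmidtCoeff_eq_zero v (by simpa using hk), zero_mul]
  dsimp only
  congr 1
  rw [torusChar, Finsupp.prod, Finset.prod_congr rfl fun n hn => by rw [h1 n hn]]
  simp only [← Circle.exp_zsmul]
  rw [← circle_exp_sum]
  congr 1
  simp only [hw, Finsupp.sum, inner_sum, inner_smul_right, zsmul_eq_mul, Finset.mul_sum,
    Finset.sum_mul]
  rw [Finset.sum_comm]
  refine Finset.sum_congr rfl fun k _ => Finset.sum_congr rfl fun n _ => ?_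
  rw [gramSchmidtCoeff, mul_assoc]

end Gaussian

/-! ### Convergence to zero in absolute Cesàro mean and Wiener's lemma -/

/-- The absolute values of `u` tend to zero in the sense of Cesàro. -/
def CesaroNull (u : ℕ → ℂ) : Prop :=
  Tendsto (fun N : ℕ => (N : ℝ)⁻¹ * ∑ n ∈ Finset.range N, ‖u n‖) atTop (𝓝 0)

lemma CesaroNull.of_norm_le {u v : ℕ → ℂ} (hv : CesaroNull v) (C : ℝ)
    (h : ∀ n, ‖u n‖ ≤ C * ‖v n‖) : CesaroNull u := by
  have h0 := Tendsto.const_mul C hv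
  rw [mul_zero] at h0
  refine squeeze_zero (fun N => by positivity) (fun N => ?_) h0
  rw [mul_left_comm, Finset.mul_sum (a := C)]
  exact mul_le_mul_of_nonneg_left (Finset.sum_le_sum fun n _ => h n)
    (inv_nonneg.2 N.cast_nonneg)

lemma CesaroNull.add {u v : ℕ → ℂ} (hu : CesaroNull u) (hv : CesaroNull v) :
    CesaroNull fun n => u n + v n := by
  have h0 := Tendsto.add hu hv
  rw [add_zero] at h0
  refine squeeze_zero (fun N => by positivity) (fun N => ?_) h0
  rw [← mul_add, ← Finset.sum_add_distrib]
  gcongr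
  exact norm_add_le _ _

lemma cesaroNull_zero : CesaroNull fun _ => 0 := by simp [CesaroNull]

lemma CesaroNull.sum {ι : Type*} (s : Finset ι) {u : ι → ℕ → ℂ} (h : ∀ i ∈ s, CesaroNull (u i)) :
    CesaroNull fun n => ∑ i ∈ s, u i n := by
  classical
  induction s using Finset.induction_on with
  | empty => simpa using cesaroNull_zero
  | insert i s hi ih =>
    simp only [Finset.sum_insert hi]
    exact (h i (by simp)).add (ih fun j hj => h j (by simp [hj]))

lemma CesaroNull.const_mul {u : ℕ → ℂ} (hu : CesaroNull u) (c : ℂ) :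
    CesaroNull fun n => c * u n :=
  hu.of_norm_le ‖c‖ fun _ => (norm_mul _ _).le

lemma CesaroNull.of_forall_approx {u : ℕ → ℂ}
    (h : ∀ ε > 0, ∃ v, CesaroNull v ∧ ∀ n, ‖u n‖ ≤ ‖v n‖ + ε) : CesaroNull u := by
  rw [CesaroNull, Metric.tendsto_atTop]
  intro ε hε
  obtain ⟨v, hv, huv⟩ := h (ε / 2) (by positivity)
  obtain ⟨N, hN⟩ := Metric.tendsto_atTop.1 hv (ε / 2) (by positivity)
  refine ⟨N + 1, fun n hn => ?_⟩
  have h1 := hN n (by omega)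
  have hn0 : (0 : ℝ) < n := by exact_mod_cast (by omega : 0 < n)
  rw [Real.dist_eq, sub_zero, abs_of_nonneg (by positivity)] at h1 ⊢
  calc (n : ℝ)⁻¹ * ∑ k ∈ Finset.range n, ‖u k‖
      ≤ (n : ℝ)⁻¹ * ∑ k ∈ Finset.range n, (‖v k‖ + ε / 2) := by gcongr; exact huv _
    _ = (n : ℝ)⁻¹ * ∑ k ∈ Finset.range n, ‖v k‖ + ε / 2 := by
        rw [Finset.sum_add_distrib, mul_add]
        simp
        field_simp
    _ < ε := by linarith

/-- Cauchy–Schwarz: the square of a mean is at most the mean of the squares. -/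
lemma CesaroNull.of_sq {u : ℕ → ℂ} (h : CesaroNull fun n => u n * starRingEnd ℂ (u n)) :
    CesaroNull u := by
  have h0 := (Real.continuous_sqrt.tendsto 0).comp h
  rw [Real.sqrt_zero] at h0
  refine squeeze_zero (fun N => by positivity) (fun N => Real.le_sqrt_of_sq_le ?_) h0
  rcases Nat.eq_zero_or_pos N with rfl | hN
  · simp
  have hN' : (0 : ℝ) < N := by exact_mod_cast hN
  have h1 := sq_sum_le_card_mul_sum_sq (s := Finset.range N) (f := fun n => ‖u n‖)
  rw [Finset.card_range] at h1
  simp only [norm_mul, RCLike.norm_conj, ← sq]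
  rw [mul_pow, ← div_eq_inv_mul, inv_pow, ← div_eq_inv_mul, div_le_div_iff₀ (by positivity) hN']
  nlinarith

open scoped Classical in
lemma tendsto_cesaro_circle_pow (ζ : Circle) :
    Tendsto (fun N : ℕ => (N : ℂ)⁻¹ * ∑ n ∈ Finset.range N, (ζ : ℂ) ^ n) atTop
      (𝓝 (if ζ = 1 then 1 else 0)) := by
  split_ifs with h
  · refine tendsto_const_nhds.congr' ?_
    filter_upwards [eventually_ne_atTop 0] with N hN
    simp [h, hN]
  · have h' : (ζ : ℂ) ≠ 1 := fun h1 => h (Circle.coe_eq_one.1 h1)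
    have h0 : Tendsto (fun N : ℕ => (N : ℝ)⁻¹ * (2 / ‖(ζ : ℂ) - 1‖)) atTop (𝓝 0) := by
      simpa using tendsto_inv_atTop_nhds_zero_nat.mul_const (2 / ‖(ζ : ℂ) - 1‖)
    refine squeeze_zero_norm (fun N => ?_) h0
    rw [norm_mul, norm_inv, Complex.norm_natCast, geom_sum_eq h', norm_div]
    gcongr
    refine (norm_sub_le _ _).trans ?_
    rw [norm_pow, Circle.norm_coe, one_pow, norm_one]
    norm_num

lemma norm_cesaro_circle_pow_le (ζ : Circle) (N : ℕ) :
    ‖(N : ℂ)⁻¹ * ∑ n ∈ Finset.range N, (ζ : ℂ) ^ n‖ ≤ 1 := by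
  rw [norm_mul, norm_inv, Complex.norm_natCast]
  calc (N : ℝ)⁻¹ * ‖∑ n ∈ Finset.range N, (ζ : ℂ) ^ n‖
      ≤ (N : ℝ)⁻¹ * ∑ n ∈ Finset.range N, ‖(ζ : ℂ) ^ n‖ := by gcongr; exact norm_sum_le _ _
    _ ≤ 1 := by
        simp only [norm_pow, Circle.norm_coe, one_pow, Finset.sum_const, Finset.card_range,
          nsmul_eq_mul, mul_one]
        exact inv_mul_le_one

lemma ae_prod_fst_ne_snd (σ : Measure Circle) [IsFiniteMeasure σ] (hσ : ∀ z, σ {z} = 0) :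
    ∀ᵐ p ∂σ.prod σ, p.1 ≠ p.2 := by
  have hm : MeasurableSet {p : Circle × Circle | p.1 = p.2} :=
    measurableSet_eq_fun measurable_fst measurable_snd
  rw [ae_iff]
  simp only [not_not]
  rw [Measure.prod_apply hm]
  simp only [Set.preimage_ofPred_eq]
  have : ∀ x : Circle, {a | x = a} = {x} := fun x => by ext; simp [eq_comm]
  simp [this, hσ]

/-- Wiener's lemma: the Fourier coefficients of a continuous measure tend to zero in absolute
Cesàro mean. -/
lemma cesaroNull_integral_pow_mul (σ : Measure Circle) [IsFiniteMeasure σ] (hσ : ∀ z, σ {z} = 0)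
    (h : C(Circle, ℂ)) : CesaroNull fun n => ∫ z, (z : ℂ) ^ n * h z ∂σ := by
  refine CesaroNull.of_sq ?_
  set u : ℕ → ℂ := fun n => ∫ z, (z : ℂ) ^ n * h z ∂σ with hu
  have hc : Continuous fun z : Circle => (z : ℂ) := continuous_subtype_val
  -- By Fubini the mean of |u n|² is an integral over σ × σ whose kernel, the mean of (z w⁻¹) ^ n,
  -- tends boundedly to the indicator of the diagonal. That set is null since σ has no atoms.
  have key : ∀ N : ℕ, (N : ℂ)⁻¹ * ∑ n ∈ Finset.range N, u n * starRingEnd ℂ (u n) =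
      ∫ p, ((N : ℂ)⁻¹ * ∑ n ∈ Finset.range N, ((p.1 * p.2⁻¹ : Circle) : ℂ) ^ n) *
        (h p.1 * starRingEnd ℂ (h p.2)) ∂σ.prod σ := by
    intro N
    have h1 : ∀ n, u n * starRingEnd ℂ (u n) =
        ∫ p, ((p.1 * p.2⁻¹ : Circle) : ℂ) ^ n * (h p.1 * starRingEnd ℂ (h p.2)) ∂σ.prod σ := by
      intro n
      rw [hu]
      dsimp only
      rw [← integral_conj, ← integral_prod_mul]
      refine integral_congr_ae (ae_of_all _ fun p => ?_)
      simp only [Circle.coe_mul, Circle.coe_inv_eq_conj, map_mul, map_pow]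
      ring
    rw [Finset.sum_congr rfl fun n _ => h1 n, ← integral_finsetSum, ← integral_const_mul]
    · refine integral_congr_ae (ae_of_all _ fun p => ?_)
      simp only [Finset.sum_mul, mul_assoc]
    · intro n _
      refine (BoundedContinuousFunction.mkOfCompact (⟨fun p : Circle × Circle =>
        ((p.1 * p.2⁻¹ : Circle) : ℂ) ^ n * (h p.1 * starRingEnd ℂ (h p.2)), ?_⟩ :
          C(Circle × Circle, ℂ))).integrable _
      have : Continuous fun p : Circle × Circle => ((p.1 * p.2⁻¹ : Circle) : ℂ) :=
        hc.comp (by fun_prop)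
      fun_prop
  have hlim : Tendsto (fun N : ℕ => (N : ℂ)⁻¹ * ∑ n ∈ Finset.range N, u n * starRingEnd ℂ (u n))
      atTop (𝓝 (∫ _, (0 : ℂ) ∂σ.prod σ)) := by
    simp only [key]
    have hb : Continuous fun p : Circle × Circle => h p.1 * starRingEnd ℂ (h p.2) := by fun_prop
    refine tendsto_integral_of_dominated_convergence (fun _ => ‖h‖ * ‖h‖) (fun N => ?_)
      (integrable_const _) (fun N => ae_of_all _ fun p => ?_) ?_
    · have : Continuous fun p : Circle × Circle => ((p.1 * p.2⁻¹ : Circle) : ℂ) :=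
        hc.comp (by fun_prop)
      exact Continuous.aestronglyMeasurable (by fun_prop)
    · rw [norm_mul, norm_mul (h p.1), RCLike.norm_conj]
      calc _ ≤ 1 * (‖h‖ * ‖h‖) := by
            gcongr
            · exact norm_cesaro_circle_pow_le _ _
            · exact h.norm_coe_le_norm _
            · exact h.norm_coe_le_norm _
        _ = _ := one_mul _
    · filter_upwards [ae_prod_fst_ne_snd σ hσ] with p hp
      have := (tendsto_cesaro_circle_pow (p.1 * p.2⁻¹)).mul_const (h p.1 * starRingEnd ℂ (h p.2))
      rwa [if_neg (by rwa [mul_inv_eq_one]), zero_mul] at this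
  rw [integral_zero] at hlim
  have := hlim.norm
  rw [norm_zero] at this
  refine this.congr fun N => ?_
  have hs : ∀ n, u n * starRingEnd ℂ (u n) = ((‖u n‖ ^ 2 : ℝ) : ℂ) := fun n => by
    rw [RCLike.mul_conj]; push_cast; rfl
  have hs' : ∀ n, ‖u n * starRingEnd ℂ (u n)‖ = ‖u n‖ ^ 2 := fun n => by
    rw [norm_mul, RCLike.norm_conj, sq]
  rw [norm_mul, norm_inv, Complex.norm_natCast, Finset.sum_congr rfl fun n _ => hs n,
    Finset.sum_congr rfl fun n _ => hs' n, ← Complex.ofReal_sum, Complex.norm_real,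
    Real.norm_of_nonneg (by positivity)]

open scoped Classical in
/-- A finite measure on the circle whose Fourier coefficients tend to zero in absolute Cesàro mean
has no atoms. -/
lemma measure_singleton_eq_zero_of_cesaroNull (μ : Measure Circle) [IsFiniteMeasure μ]
    (h : CesaroNull fun n => ∫ z, (z : ℂ) ^ n ∂μ) (w : Circle) : μ {w} = 0 := by
  have hc : Continuous fun z : Circle => (z : ℂ) := continuous_subtype_val
  have hcw : Continuous fun z : Circle => ((z * w⁻¹ : Circle) : ℂ) := hc.comp (by fun_prop)
  -- The means of (z w⁻¹) ^ n converge to the indicator of {w}; their integrals are bounded by the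
  -- Cesàro means of the absolute Fourier coefficients.
  have hlim : Tendsto (fun N : ℕ => ∫ z, (N : ℂ)⁻¹ * ∑ n ∈ Finset.range N,
      ((z * w⁻¹ : Circle) : ℂ) ^ n ∂μ) atTop (𝓝 (∫ z, (if z = w then 1 else 0 : ℂ) ∂μ)) := by
    refine tendsto_integral_of_dominated_convergence (fun _ => 1) (fun N => ?_)
      (integrable_const _) (fun N => ae_of_all _ fun z => norm_cesaro_circle_pow_le _ _)
      (ae_of_all _ fun z => ?_)
    · exact Continuous.aestronglyMeasurable (by fun_prop)
    · simpa only [mul_inv_eq_one] using tendsto_cesaro_circle_pow (z * w⁻¹)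
  have hval : ∫ z, (if z = w then 1 else 0 : ℂ) ∂μ = (μ.real {w} : ℂ) := by
    have : (fun z => (if z = w then 1 else 0 : ℂ)) = Set.indicator {w} fun _ => 1 := by
      ext z; simp [Set.indicator_apply]
    rw [this, integral_indicator_const _ (measurableSet_singleton w)]
    simp
  have hzero : Tendsto (fun N : ℕ => ∫ z, (N : ℂ)⁻¹ * ∑ n ∈ Finset.range N,
      ((z * w⁻¹ : Circle) : ℂ) ^ n ∂μ) atTop (𝓝 0) := by
    refine squeeze_zero_norm (fun N => ?_) h
    rw [integral_const_mul, integral_finsetSum, norm_mul, norm_inv, Complex.norm_natCast]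
    · gcongr
      refine (norm_sum_le _ _).trans (Finset.sum_le_sum fun n _ => ?_)
      simp only [Circle.coe_mul, mul_pow]
      rw [integral_mul_const, norm_mul, norm_pow, Circle.norm_coe, one_pow, mul_one]
    · intro n _
      exact (BoundedContinuousFunction.mkOfCompact (⟨fun z : Circle =>
        ((z * w⁻¹ : Circle) : ℂ) ^ n, by fun_prop⟩ : C(Circle, ℂ))).integrable _
  have := tendsto_nhds_unique hlim hzero
  rw [hval, Complex.ofReal_eq_zero] at this
  exact (measureReal_eq_zero_iff).1 this

/-! ### The shift on the infinite torus and its Gaussian invariant measures -/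

/-- The shift of the infinite torus. -/
def torusShift (x : ℕ → Circle) : ℕ → Circle := fun n => x (n + 1)

/-- The translate of a frequency vector by `n`. -/
def freqShift (n : ℕ) (a : ℕ →₀ ℤ) : ℕ →₀ ℤ := a.mapDomain (· + n)

lemma torusShift_iterate (n : ℕ) (x : ℕ → Circle) : torusShift^[n] x = fun k => x (k + n) := by
  induction n with
  | zero => rfl
  | succ n ih =>
    rw [Function.iterate_succ_apply', ih]
    ext k
    simp only [torusShift]
    congr 2
    ring

lemma torusChar_freqShift (n : ℕ) (a : ℕ →₀ ℤ) (x : ℕ → Circle) :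
    torusChar (freqShift n a) x = torusChar a (torusShift^[n] x) := by
  rw [torusShift_iterate, torusChar, freqShift, Finsupp.prod_mapDomain_index (by simp)
    (fun _ _ _ => zpow_add _ _ _)]
  rfl

lemma measurable_torusShift : Measurable torusShift :=
  measurable_pi_lambda _ fun n => measurable_pi_apply (n + 1)

/-- The polynomial `∑ a_n z^n` on the circle. -/
def circlePoly (a : ℕ →₀ ℤ) : C(Circle, ℂ) :=
  a.sum fun n r => (r : ℝ) • ⟨fun z : Circle => (z : ℂ) ^ n, continuous_subtype_val.pow n⟩

lemma circlePoly_apply (a : ℕ →₀ ℤ) (z : Circle) :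
    circlePoly a z = a.sum fun n r => (r : ℂ) * (z : ℂ) ^ n := by
  simp [circlePoly, Finsupp.sum, ContinuousMap.sum_apply]
  rfl

lemma circlePoly_sub (a b : ℕ →₀ ℤ) (z : Circle) :
    circlePoly (a - b) z = circlePoly a z - circlePoly b z := by
  simp only [circlePoly_apply]
  exact Finsupp.sum_sub_index fun n r s => by push_cast; ring

lemma circlePoly_zero : circlePoly 0 = 0 := by simp [circlePoly]

lemma circlePoly_freqShift (n : ℕ) (a : ℕ →₀ ℤ) (z : Circle) :
    circlePoly (freqShift n a) z = (z : ℂ) ^ n * circlePoly a z := by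
  rw [circlePoly_apply, circlePoly_apply, freqShift, Finsupp.sum_mapDomain_index (by simp)
    (fun _ _ _ => by push_cast; ring), Finsupp.mul_sum]
  refine Finsupp.sum_congr fun k _ => ?_
  rw [pow_add]
  ring

/-- `m` is the law of the exponential of a stationary Gaussian process of spectral measure `σ`. -/
def IsGaussianTorusMeasure (σ : Measure Circle) (m : Measure (ℕ → Circle)) : Prop :=
  ∀ a, ∫ x, (torusChar a x : ℂ) ∂m = Real.exp (-(∫ z, ‖circlePoly a z‖ ^ 2 ∂σ) / 2)

/-- The general construction is applied to the vectors z ^ n in L²(σ), regarded as a real Hilbert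
space. -/
lemma exists_isGaussianTorusMeasure (σ : Measure Circle) [IsFiniteMeasure σ] :
    ∃ m : Measure (ℕ → Circle), IsProbabilityMeasure m ∧ IsGaussianTorusMeasure σ m := by
  let J := ContinuousMap.toLp (E := ℂ) 2 σ ℝ
  obtain ⟨m, hm, h⟩ := exists_gaussian_torus_measure (E := Lp ℂ 2 σ)
    (fun n => J ⟨fun z : Circle => (z : ℂ) ^ n, continuous_subtype_val.pow n⟩)
  refine ⟨m, hm, fun a => ?_⟩
  have hsum : (a.sum fun n r => (r : ℝ) • J ⟨fun z : Circle => (z : ℂ) ^ n,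
      continuous_subtype_val.pow n⟩) = J (circlePoly a) := by
    simp only [circlePoly, Finsupp.sum, map_sum, map_smul]
  rw [h a, hsum, ← real_inner_self_eq_norm_sq, L2.inner_def]
  congr 4
  refine integral_congr_ae ?_
  filter_upwards [ContinuousMap.coeFn_toLp (p := 2) (𝕜 := ℝ) σ (circlePoly a)] with z hz
  rw [hz, real_inner_self_eq_norm_sq]

section System

variable {σ : Measure Circle} {m : Measure (ℕ → Circle)}

/-- Shifting the frequencies multiplies `circlePoly a` by z, of modulus 1, so the Fourier
coefficients do not change. -/
lemma IsGaussianTorusMeasure.measurePreserving [IsProbabilityMeasure m]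
    (hm : IsGaussianTorusMeasure σ m) :
    MeasurePreserving torusShift m m := by
  refine ⟨measurable_torusShift, ?_⟩
  have : IsProbabilityMeasure (m.map torusShift) :=
    Measure.isProbabilityMeasure_map measurable_torusShift.aemeasurable
  refine ext_of_integral_torusChar fun a => ?_
  refine (integral_map (f := fun x => (torusChar a x : ℂ)) measurable_torusShift.aemeasurable
    (torusCharC a).continuous.aestronglyMeasurable).trans ?_
  have h1 : ∀ x, torusChar a (torusShift x) = torusChar (freqShift 1 a) x := fun x => by
    rw [torusChar_freqShift]; rfl
  simp only [h1]
  rw [hm, hm]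
  simp only [circlePoly_freqShift, norm_mul, norm_pow, Circle.norm_coe, one_pow, one_mul]

/-- The character `torusChar a` as an element of `L²`. -/
def charLp (m : Measure (ℕ → Circle)) [IsProbabilityMeasure m] (a : ℕ →₀ ℤ) : Lp ℂ 2 m :=
  ContinuousMap.toLp 2 m ℂ (torusCharC a)

lemma IsGaussianTorusMeasure.inner_charLp [IsProbabilityMeasure m]
    (hm : IsGaussianTorusMeasure σ m) (a b : ℕ →₀ ℤ) :
    inner ℂ (charLp m b) (charLp m a) =
      Real.exp (-(∫ z, ‖circlePoly a z - circlePoly b z‖ ^ 2 ∂σ) / 2) := by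
  rw [charLp, charLp, ContinuousMap.inner_toLp]
  simp only [torusCharC_apply, ← torusChar_sub, hm (a - b), circlePoly_sub]

lemma IsGaussianTorusMeasure.norm_charLp [IsProbabilityMeasure m]
    (hm : IsGaussianTorusMeasure σ m) (a : ℕ →₀ ℤ) : ‖charLp m a‖ = 1 := by
  have h : ‖charLp m a‖ ^ 2 = 1 := by
    rw [← inner_self_eq_norm_sq (𝕜 := ℂ), hm.inner_charLp]
    simp
  nlinarith [norm_nonneg (charLp m a)]

/-- The iterates of the Koopman operator of the shift. -/
def koopman (hT : MeasurePreserving torusShift m m) (n : ℕ) : Lp ℂ 2 m →ₗᵢ[ℂ] Lp ℂ 2 m :=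
  Lp.compMeasurePreservingₗᵢ ℂ (torusShift^[n]) (hT.iterate n)

lemma coeFn_koopman (hT : MeasurePreserving torusShift m m) (n : ℕ) (F : Lp ℂ 2 m) :
    koopman hT n F =ᵐ[m] fun x => F (torusShift^[n] x) :=
  Lp.coeFn_compMeasurePreserving F (hT.iterate n)

lemma koopman_charLp [IsProbabilityMeasure m] (hT : MeasurePreserving torusShift m m) (n : ℕ) (a : ℕ →₀ ℤ) :
    koopman hT n (charLp m a) = charLp m (freqShift n a) := by
  refine Lp.ext ?_
  have h1 := ContinuousMap.coeFn_toLp (p := 2) (𝕜 := ℂ) m (torusCharC a)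
  have h2 := ContinuousMap.coeFn_toLp (p := 2) (𝕜 := ℂ) m (torusCharC (freqShift n a))
  filter_upwards [coeFn_koopman hT n (charLp m a), h2,
    (hT.iterate n).quasiMeasurePreserving.ae_eq_comp h1] with x h3 h4 h5
  rw [h3]
  refine (h5.trans ?_).trans h4.symm
  simp [torusChar_freqShift]

lemma exists_charLp_near [IsProbabilityMeasure m] (F : Lp ℂ 2 m) {ε : ℝ} (hε : 0 < ε) :
    ∃ c : (ℕ →₀ ℤ) →₀ ℂ, ‖F - c.sum fun a r => r • charLp m a‖ < ε := by
  obtain ⟨c, hc⟩ := exists_torus_polynomial_Lp_near m F hε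
  refine ⟨c, ?_⟩
  simp only [Finsupp.sum, map_sum, map_smul] at hc
  exact hc

/-! ### Weak mixing -/

lemma norm_sub_sq_expand (u v : ℂ) :
    ‖u - v‖ ^ 2 = ‖u‖ ^ 2 + ‖v‖ ^ 2 - 2 * (u * starRingEnd ℂ v).re := by
  rw [← Complex.normSq_eq_norm_sq, ← Complex.normSq_eq_norm_sq, ← Complex.normSq_eq_norm_sq,
    Complex.normSq_sub]

lemma integrable_circle [IsFiniteMeasure σ] {f : Circle → ℂ} (hf : Continuous f) : Integrable f σ :=
  (BoundedContinuousFunction.mkOfCompact (⟨f, hf⟩ : C(Circle, ℂ))).integrable σ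

lemma integrable_circle_real [IsFiniteMeasure σ] {f : Circle → ℝ} (hf : Continuous f) : Integrable f σ :=
  (BoundedContinuousFunction.mkOfCompact (⟨f, hf⟩ : C(Circle, ℝ))).integrable σ

lemma abs_exp_sub_one_le_mul (x : ℝ) : |Real.exp x - 1| ≤ |x| * Real.exp |x| := by
  have := Complex.norm_exp_sub_sum_le_norm_mul_exp x 1
  simpa [← Complex.ofReal_exp, ← Complex.ofReal_one, ← Complex.ofReal_sub] using this

/-- Expand |zⁿ A - B|². The square terms give the product of the means, and the cross term gives the
exponential factor, which measures the failure of independence at time n. -/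
lemma IsGaussianTorusMeasure.inner_charLp_freqShift [IsFiniteMeasure σ]
    [IsProbabilityMeasure m] (hm : IsGaussianTorusMeasure σ m)
    (a b : ℕ →₀ ℤ) (n : ℕ) :
    inner ℂ (charLp m b) (charLp m (freqShift n a)) =
      inner ℂ (charLp m b) (charLp m 0) * inner ℂ (charLp m 0) (charLp m a) *
        Real.exp (∫ z, (z : ℂ) ^ n * (circlePoly a z * starRingEnd ℂ (circlePoly b z)) ∂σ).re := by
  have hc : Continuous fun z : Circle => (z : ℂ) := continuous_subtype_val
  rw [hm.inner_charLp, hm.inner_charLp, hm.inner_charLp, ← Complex.ofReal_mul,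
    ← Complex.ofReal_mul, ← Real.exp_add, ← Real.exp_add]
  congr 2
  have hre : (∫ z, (z : ℂ) ^ n * (circlePoly a z * starRingEnd ℂ (circlePoly b z)) ∂σ).re =
      ∫ z, ((z : ℂ) ^ n * (circlePoly a z * starRingEnd ℂ (circlePoly b z))).re ∂σ :=
    (integral_re (integrable_circle (by fun_prop))).symm
  rw [hre]
  have h1 : ∀ z : Circle, ‖circlePoly (freqShift n a) z - circlePoly b z‖ ^ 2 =
      ‖circlePoly a z‖ ^ 2 + ‖circlePoly b z‖ ^ 2 -
        2 * ((z : ℂ) ^ n * (circlePoly a z * starRingEnd ℂ (circlePoly b z))).re := by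
    intro z
    rw [norm_sub_sq_expand, circlePoly_freqShift, norm_mul, norm_pow, Circle.norm_coe, one_pow,
      one_mul, mul_assoc]
  have hA : Integrable (fun z => ‖circlePoly a z‖ ^ 2) σ := integrable_circle_real (by fun_prop)
  have hB : Integrable (fun z => ‖circlePoly b z‖ ^ 2) σ := integrable_circle_real (by fun_prop)
  have hC : Integrable (fun z : Circle => 2 * ((z : ℂ) ^ n *
      (circlePoly a z * starRingEnd ℂ (circlePoly b z))).re) σ :=
    integrable_circle_real
      (continuous_const.mul (Complex.continuous_re.comp (by fun_prop)))
  simp only [h1, circlePoly_zero, ContinuousMap.zero_apply, zero_sub, norm_neg, sub_zero]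
  rw [integral_sub (f := fun z => ‖circlePoly a z‖ ^ 2 + ‖circlePoly b z‖ ^ 2) (hA.add hB) hC,
    integral_add hA hB, integral_const_mul]
  ring

/-- Wiener's lemma makes the exponent of the correlation factor Cesàro null; it is also bounded, so
exp minus 1 is dominated by a multiple of it. -/
lemma IsGaussianTorusMeasure.cesaroNull_charLp [IsFiniteMeasure σ]
    [IsProbabilityMeasure m] (hm : IsGaussianTorusMeasure σ m)
    (hσ : ∀ z, σ {z} = 0) (a b : ℕ →₀ ℤ) :
    CesaroNull fun n => inner ℂ (charLp m b) (charLp m (freqShift n a)) -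
      inner ℂ (charLp m b) (charLp m 0) * inner ℂ (charLp m 0) (charLp m a) := by
  have hc : Continuous fun z : Circle => (z : ℂ) := continuous_subtype_val
  let h : C(Circle, ℂ) := ⟨fun z => circlePoly a z * starRingEnd ℂ (circlePoly b z), by fun_prop⟩
  set P : ℂ := inner ℂ (charLp m b) (charLp m 0) * inner ℂ (charLp m 0) (charLp m a)
  refine (cesaroNull_integral_pow_mul σ hσ h).of_norm_le (‖P‖ * Real.exp (‖h‖ * σ.real Set.univ))
    fun n => ?_
  set r : ℂ := ∫ z, (z : ℂ) ^ n * h z ∂σ with hr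
  have hrb : ‖r‖ ≤ ‖h‖ * σ.real Set.univ := by
    refine norm_integral_le_of_norm_le_const (ae_of_all _ fun z => ?_)
    rw [norm_mul, norm_pow, Circle.norm_coe, one_pow, one_mul]
    exact h.norm_coe_le_norm z
  have h1 : inner ℂ (charLp m b) (charLp m (freqShift n a)) - P = P * ((Real.exp r.re - 1 : ℝ) : ℂ) := by
    rw [hm.inner_charLp_freqShift]
    change P * (Real.exp r.re : ℂ) - P = _
    push_cast
    ring
  rw [h1, norm_mul, Complex.norm_real, Real.norm_eq_abs, mul_assoc]
  gcongr
  calc |Real.exp r.re - 1| ≤ |r.re| * Real.exp |r.re| := abs_exp_sub_one_le_mul _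
    _ ≤ ‖r‖ * Real.exp (‖h‖ * σ.real Set.univ) := by
        have := Complex.abs_re_le_norm r
        gcongr
        exact this.trans hrb
    _ = _ := mul_comm _ _

lemma IsGaussianTorusMeasure.cesaroNull_inner_koopman [IsFiniteMeasure σ]
    [IsProbabilityMeasure m] (hm : IsGaussianTorusMeasure σ m)
    (hσ : ∀ z, σ {z} = 0) {F : Lp ℂ 2 m} (hF : inner ℂ (charLp m 0) F = 0) :
    CesaroNull fun n => inner ℂ F (koopman hm.measurePreserving n F) := by
  refine CesaroNull.of_forall_approx fun ε hε => ?_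
  have hX0 : ‖charLp m 0‖ = 1 := hm.norm_charLp 0
  -- Replacing `F` by a polynomial within δ costs δ‖F‖ + (‖F‖ + δ)δ in the correlation, and δ² for
  -- the product of means, which is zero for `F` but not exactly for the polynomial.
  obtain ⟨δ, hδ, hδε⟩ : ∃ δ > 0, δ * (2 * ‖F‖ + δ) + δ * δ ≤ ε := by
    refine ⟨min 1 (ε / (2 * ‖F‖ + 2)), by positivity, ?_⟩
    set δ := min 1 (ε / (2 * ‖F‖ + 2))
    have h1 : δ ≤ 1 := min_le_left _ _
    have h2 : δ * (2 * ‖F‖ + 2) ≤ ε := by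
      rw [← le_div_iff₀ (by positivity)]; exact min_le_right _ _
    have h3 : 0 ≤ δ := by positivity
    nlinarith
  obtain ⟨c, hc⟩ := exists_charLp_near F hδ
  set G := c.sum fun a r => r • charLp m a with hG
  set U := koopman hm.measurePreserving with hU
  refine ⟨fun n => inner ℂ G (U n G) - inner ℂ G (charLp m 0) * inner ℂ (charLp m 0) G, ?_,
    fun n => ?_⟩
  · have h1 : ∀ n, inner ℂ G (U n G) - inner ℂ G (charLp m 0) * inner ℂ (charLp m 0) G =
        ∑ b ∈ c.support, ∑ a ∈ c.support, (starRingEnd ℂ (c b) * c a) *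
          (inner ℂ (charLp m b) (charLp m (freqShift n a)) -
            inner ℂ (charLp m b) (charLp m 0) * inner ℂ (charLp m 0) (charLp m a)) := by
      intro n
      simp only [hG, Finsupp.sum, map_sum, map_smul, hU, koopman_charLp, sum_inner, inner_sum,
        inner_smul_left, inner_smul_right, mul_sub, Finset.sum_sub_distrib, Finset.sum_mul_sum]
      congr 1
      · simp only [Finset.mul_sum]
        rw [Finset.sum_comm]
        refine Finset.sum_congr rfl fun b _ => ?_
        exact Finset.sum_congr rfl fun a _ => by ring
      · refine Finset.sum_congr rfl fun b _ => Finset.sum_congr rfl fun a _ => by ring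
    simp only [h1]
    exact CesaroNull.sum _ fun b _ => CesaroNull.sum _ fun a _ =>
      (hm.cesaroNull_charLp hσ a b).const_mul _
  · have hGn : ‖G‖ ≤ ‖F‖ + δ := by
      have := norm_sub_norm_le G F
      rw [norm_sub_rev] at this
      linarith
    have hmean : ‖inner ℂ (charLp m 0) G‖ ≤ δ := by
      have : inner ℂ (charLp m 0) G = - inner ℂ (charLp m 0) (F - G) := by
        rw [inner_sub_right, hF]; ring
      rw [this, norm_neg]
      refine (norm_inner_le_norm _ _).trans ?_
      rw [hX0, one_mul]
      exact hc.le
    have hsplit : inner ℂ F (U n F) = (inner ℂ G (U n G) -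
        inner ℂ G (charLp m 0) * inner ℂ (charLp m 0) G) + (inner ℂ (F - G) (U n F) +
        inner ℂ G (U n (F - G)) + inner ℂ G (charLp m 0) * inner ℂ (charLp m 0) G) := by
      rw [map_sub, inner_sub_left, inner_sub_right]
      ring
    rw [hsplit]
    refine (norm_add_le _ _).trans (add_le_add_right ?_ _)
    have e1 : ‖inner ℂ (F - G) (U n F)‖ ≤ δ * ‖F‖ := by
      refine (norm_inner_le_norm _ _).trans ?_
      rw [LinearIsometry.norm_map]
      gcongr
    have e2 : ‖inner ℂ G (U n (F - G))‖ ≤ (‖F‖ + δ) * δ := by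
      refine (norm_inner_le_norm _ _).trans ?_
      rw [LinearIsometry.norm_map]
      gcongr
    have e3 : ‖inner ℂ G (charLp m 0) * inner ℂ (charLp m 0) G‖ ≤ δ * δ := by
      rw [norm_mul, norm_inner_symm]
      gcongr
    refine (norm_add₃_le).trans ?_
    linarith

lemma IsGaussianTorusMeasure.isWeaklyMixing [IsFiniteMeasure σ]
    [IsProbabilityMeasure m] (hm : IsGaussianTorusMeasure σ m)
    (hσ : ∀ z, σ {z} = 0) : IsWeaklyMixing m torusShift := by
  intro f hf hf0 μ hμ w
  have := hμ.1
  refine measure_singleton_eq_zero_of_cesaroNull μ ?_ w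
  set F := hf.toLp f
  have hFf : F =ᵐ[m] f := hf.coeFn_toLp
  have hF0 : inner ℂ (charLp m 0) F = 0 := by
    rw [L2.inner_def, ← hf0]
    refine integral_congr_ae ?_
    filter_upwards [hFf, ContinuousMap.coeFn_toLp (p := 2) (𝕜 := ℂ) m (torusCharC 0)] with x h1 h2
    rw [h1, charLp, h2]
    simp [torusChar_zero]
  refine (hm.cesaroNull_inner_koopman hσ hF0).of_norm_le 1 fun n => le_of_eq ?_
  rw [one_mul, hμ.2 n, L2.inner_def]
  congr 1
  refine integral_congr_ae ?_
  filter_upwards [hFf, coeFn_koopman hm.measurePreserving n F,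
    (hm.measurePreserving.iterate n).quasiMeasurePreserving.ae_eq_comp hFf] with x h1 h2 h3
  rw [h1, h2]
  simp only [Function.comp_apply] at h3
  rw [h3]
  rfl

end System

/-! ### Rigidity -/

section Rigidity

variable {σ : Measure Circle} {m : Measure (ℕ → Circle)}

/-- Characters are unit vectors, so the squared distance is 2 - 2 exp(-I / 2), where I is the
integral of |A|² |z ^ n_k - 1|² with A = `circlePoly a` bounded. -/
lemma IsGaussianTorusMeasure.tendsto_koopman_charLp [IsFiniteMeasure σ] [IsProbabilityMeasure m]
    (hm : IsGaussianTorusMeasure σ m) {n : ℕ → ℕ}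
    (hn : Tendsto (fun k => ∫ z, ‖(z : ℂ) ^ n k - 1‖ ^ 2 ∂σ) atTop (𝓝 0)) (a : ℕ →₀ ℤ) :
    Tendsto (fun k => ‖koopman hm.measurePreserving (n k) (charLp m a) - charLp m a‖)
      atTop (𝓝 0) := by
  have hc : Continuous fun z : Circle => (z : ℂ) := continuous_subtype_val
  have hE : Tendsto (fun k => ∫ z, ‖circlePoly (freqShift (n k) a) z - circlePoly a z‖ ^ 2 ∂σ)
      atTop (𝓝 0) := by
    have h0 := hn.const_mul (‖circlePoly a‖ ^ 2)
    rw [mul_zero] at h0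
    refine squeeze_zero (fun k => integral_nonneg fun z => by positivity) (fun k => ?_) h0
    rw [← integral_const_mul]
    refine integral_mono (integrable_circle_real (by fun_prop))
      (integrable_circle_real (by fun_prop)) fun z => ?_
    have h1 : circlePoly (freqShift (n k) a) z - circlePoly a z =
        circlePoly a z * ((z : ℂ) ^ n k - 1) := by
      rw [circlePoly_freqShift]; ring
    simp only [h1, norm_mul, mul_pow]
    gcongr
    exact (circlePoly a).norm_coe_le_norm z
  have hsq : ∀ k, ‖koopman hm.measurePreserving (n k) (charLp m a) - charLp m a‖ ^ 2 =
      2 - 2 * Real.exp (-(∫ z, ‖circlePoly (freqShift (n k) a) z - circlePoly a z‖ ^ 2 ∂σ) / 2) := by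
    intro k
    rw [koopman_charLp, ← norm_neg, neg_sub, norm_sub_sq (𝕜 := ℂ), hm.norm_charLp, hm.norm_charLp,
      hm.inner_charLp]
    simp only [RCLike.re_to_complex, Complex.ofReal_re]
    ring
  have h2 : Tendsto (fun k => 2 - 2 * Real.exp
      (-(∫ z, ‖circlePoly (freqShift (n k) a) z - circlePoly a z‖ ^ 2 ∂σ) / 2)) atTop (𝓝 0) := by
    have h3 := (((Real.continuous_exp.tendsto _).comp
      (hE.neg.div_const 2)).const_mul 2).const_sub 2
    simpa using h3
  simp only [← hsq] at h2
  have h4 := (Real.continuous_sqrt.tendsto 0).comp h2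
  simpa [Function.comp_def, Real.sqrt_sq] using h4

lemma IsGaussianTorusMeasure.tendsto_koopman [IsFiniteMeasure σ] [IsProbabilityMeasure m]
    (hm : IsGaussianTorusMeasure σ m) {n : ℕ → ℕ}
    (hn : Tendsto (fun k => ∫ z, ‖(z : ℂ) ^ n k - 1‖ ^ 2 ∂σ) atTop (𝓝 0)) (F : Lp ℂ 2 m) :
    Tendsto (fun k => ‖koopman hm.measurePreserving (n k) F - F‖) atTop (𝓝 0) := by
  set U := koopman hm.measurePreserving with hU
  rw [Metric.tendsto_atTop]
  intro ε hε
  obtain ⟨c, hcF⟩ := exists_charLp_near F (show 0 < ε / 4 by positivity)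
  set G := c.sum fun a r => r • charLp m a with hG
  have hGt : Tendsto (fun k => ∑ a ∈ c.support, ‖c a‖ * ‖U (n k) (charLp m a) - charLp m a‖)
      atTop (𝓝 0) := by
    have := tendsto_finsetSum c.support fun a _ =>
      (hm.tendsto_koopman_charLp hn a).const_mul ‖c a‖
    simpa using this
  obtain ⟨K, hK⟩ := Metric.tendsto_atTop.1 hGt (ε / 4) (by positivity)
  refine ⟨K, fun k hk => ?_⟩
  have h1 := hK k hk
  rw [Real.dist_eq, sub_zero, abs_of_nonneg (by positivity)] at h1 ⊢
  have h2 : ‖U (n k) G - G‖ ≤ ∑ a ∈ c.support, ‖c a‖ * ‖U (n k) (charLp m a) - charLp m a‖ := by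
    have : U (n k) G - G = ∑ a ∈ c.support, c a • (U (n k) (charLp m a) - charLp m a) := by
      simp only [hG, Finsupp.sum, map_sum, map_smul, smul_sub, Finset.sum_sub_distrib]
    rw [this]
    refine (norm_sum_le _ _).trans (Finset.sum_le_sum fun a _ => (norm_smul _ _).le)
  have h3 : U (n k) F - F = U (n k) (F - G) - (F - G) + (U (n k) G - G) := by
    rw [map_sub]; abel
  rw [h3]
  have h4 := norm_add_le (U (n k) (F - G) - (F - G)) (U (n k) G - G)
  have h5 := norm_sub_le (U (n k) (F - G)) (F - G)
  rw [LinearIsometry.norm_map] at h5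
  linarith

lemma IsGaussianTorusMeasure.isRigidFor [IsFiniteMeasure σ] [IsProbabilityMeasure m]
    (hm : IsGaussianTorusMeasure σ m) {n : ℕ → ℕ}
    (hn : Tendsto (fun k => ∫ z, ‖(z : ℂ) ^ n k - 1‖ ^ 2 ∂σ) atTop (𝓝 0)) :
    IsRigidFor m torusShift n := by
  intro A hA
  have hT := hm.measurePreserving
  have h := hm.tendsto_koopman hn (indicatorConstLp 2 hA (measure_ne_top m A) (1 : ℂ))
  have h1 : ∀ k, ‖koopman hT (n k) (indicatorConstLp 2 hA (measure_ne_top m A) (1 : ℂ)) -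
      indicatorConstLp 2 hA (measure_ne_top m A) (1 : ℂ)‖ ^ 2 =
      m.real (symmDiff (torusShift^[n k] ⁻¹' A) A) := by
    intro k
    have h2 : koopman hT (n k) (indicatorConstLp 2 hA (measure_ne_top m A) (1 : ℂ)) =
        indicatorConstLp 2 ((hT.iterate (n k)).measurable hA) (measure_ne_top m _) (1 : ℂ) :=
      Lp.indicatorConstLp_compMeasurePreserving hA _ (1 : ℂ) (hT.iterate (n k))
    rw [h2, ← dist_eq_norm, dist_indicatorConstLp_eq_norm,
      norm_indicatorConstLp (by simp) (by simp), norm_one, one_mul, ← Real.rpow_natCast,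
      ← Real.rpow_mul measureReal_nonneg]
    simp
  have h2 := h.pow 2
  simp only [h1] at h2
  rw [zero_pow two_ne_zero] at h2
  have h3 := ENNReal.tendsto_ofReal h2
  simpa [ofReal_measureReal] using h3

/-- Under a zero-one law the first coordinate would be almost surely constant, with mean of modulus
1; but its mean is exp(-1/2). -/
lemma IsGaussianTorusMeasure.exists_measure_pos_lt_one [IsProbabilityMeasure σ]
    [IsProbabilityMeasure m] (hm : IsGaussianTorusMeasure σ m) :
    ∃ A : Set (ℕ → Circle), MeasurableSet A ∧ 0 < m A ∧ m A < 1 := by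
  by_contra! hcon
  obtain ⟨w, hw⟩ := exists_eventuallyEq_const_of_forall_separating (l := ae m)
    (f := fun x : ℕ → Circle => x 0) MeasurableSet fun U hU => by
      have hA : MeasurableSet ((fun x : ℕ → Circle => x 0) ⁻¹' U) := measurable_pi_apply 0 hU
      rcases eq_or_ne (m ((fun x : ℕ → Circle => x 0) ⁻¹' U)) 0 with h0 | h0
      · right
        exact measure_eq_zero_iff_ae_notMem.1 h0
      · left
        exact (mem_ae_iff_prob_eq_one hA).2
          (le_antisymm prob_le_one (hcon _ hA (pos_iff_ne_zero.2 h0)))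
  have h1 := hm (Finsupp.single 0 1)
  have h2 : ∫ x, (torusChar (Finsupp.single 0 1) x : ℂ) ∂m = (w : ℂ) := by
    have : ∫ x, (torusChar (Finsupp.single 0 1) x : ℂ) ∂m = ∫ _, (w : ℂ) ∂m := by
      refine integral_congr_ae ?_
      filter_upwards [hw] with x hx
      rw [torusChar_single, hx]
      rfl
    rw [this]
    simp
  have h3 : ∀ z, circlePoly (Finsupp.single 0 1) z = 1 := fun z => by
    rw [circlePoly_apply]; simp
  rw [h2] at h1
  simp only [h3] at h1
  have h4 := congrArg norm h1
  rw [Circle.norm_coe, Complex.norm_real, Real.norm_of_nonneg (Real.exp_pos _).le] at h4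
  have h5 : Real.exp (-(∫ _, ‖(1 : ℂ)‖ ^ 2 ∂σ) / 2) < 1 := by
    rw [Real.exp_lt_one_iff]
    simp only [norm_one, one_pow, integral_const, probReal_univ, smul_eq_mul, mul_one]
    norm_num
  linarith

end Rigidity

/-- A sequence along which `z ^ n_k → 1` in `L²(σ)` for some continuous probability measure `σ` on
the circle is a rigidity sequence. -/
theorem isRigiditySequence_of_circle_measure (σ : Measure Circle) [IsProbabilityMeasure σ]
    (hσ : ∀ z, σ {z} = 0) {n : ℕ → ℕ}
    (hn : Tendsto (fun k => ∫ z, ‖(z : ℂ) ^ n k - 1‖ ^ 2 ∂σ) atTop (𝓝 0)) :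
    IsRigiditySequence n := by
  obtain ⟨m, hmp, hm⟩ := exists_isGaussianTorusMeasure σ
  exact ⟨ℕ → Circle, inferInstance, m, torusShift, hmp, hm.exists_measure_pos_lt_one,
    hm.measurePreserving, hm.isWeaklyMixing hσ, hm.isRigidFor hn⟩

/-! ### A lower bound for the Erdős–Taylor sequence on dyadic blocks -/

lemma norm_circle_pow_sub_one_le (w : Circle) (j : ℕ) :
    ‖(w : ℂ) ^ j - 1‖ ≤ j * ‖(w : ℂ) - 1‖ := by
  induction j with
  | zero => simp
  | succ j ih =>
    have h : (w : ℂ) ^ (j + 1) - 1 = (w : ℂ) ^ j * (w - 1) + (w ^ j - 1) := by ring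
    rw [h]
    refine (norm_add_le _ _).trans ?_
    rw [norm_mul, norm_pow, Circle.norm_coe, one_pow, one_mul]
    push_cast
    linarith

/-- The recursion reads z ^ p_{j+1} = (z ^ p_j) ^ j · z, so z is near 1 as soon as z ^ p_{j+1} and
(z ^ p_j) ^ j are. -/
lemma norm_sub_one_le_erdosTaylor (z : Circle) (j : ℕ) :
    ‖(z : ℂ) - 1‖ ≤ ‖(z : ℂ) ^ erdosTaylor (j + 1) - 1‖ + j * ‖(z : ℂ) ^ erdosTaylor j - 1‖ := by
  have h1 : (z : ℂ) ^ erdosTaylor (j + 1) = ((z : ℂ) ^ erdosTaylor j) ^ j * z := by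
    rw [erdosTaylor, pow_succ, mul_comm j, pow_mul]
  have h2 := norm_circle_pow_sub_one_le (z ^ erdosTaylor j) j
  rw [Circle.coe_pow] at h2
  have h3 : ‖((z : ℂ) ^ erdosTaylor j) ^ j * ((z : ℂ) - 1)‖ = ‖(z : ℂ) - 1‖ := by
    rw [norm_mul, norm_pow, norm_pow, Circle.norm_coe, one_pow, one_pow, one_mul]
  rw [← h3, h1]
  have h4 : ((z : ℂ) ^ erdosTaylor j) ^ j * ((z : ℂ) - 1) =
      (((z : ℂ) ^ erdosTaylor j) ^ j * z - 1) - (((z : ℂ) ^ erdosTaylor j) ^ j - 1) := by ring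
  rw [h4]
  exact (norm_sub_le _ _).trans (by gcongr)

/-- Adding the previous inequality over a block, the number of inequalities and the weights j are
both of order 2 ^ i, so the constant does not depend on i. -/
lemma norm_sub_one_le_sum_dyadicBlock (z : Circle) {i : ℕ} (hi : 1 ≤ i) :
    ‖(z : ℂ) - 1‖ ≤ 5 * ∑ j ∈ dyadicBlock i, ‖(z : ℂ) ^ erdosTaylor j - 1‖ := by
  set a : ℕ → ℝ := fun j => ‖(z : ℂ) ^ erdosTaylor j - 1‖ with ha
  have ha0 : ∀ j, 0 ≤ a j := fun j => norm_nonneg _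
  set S := ∑ j ∈ dyadicBlock i, a j with hS
  have hpow : 2 ^ (i + 1) = 2 * 2 ^ i := by ring
  have hx : 2 ≤ 2 ^ i := by
    calc 2 = 2 ^ 1 := rfl
      _ ≤ 2 ^ i := Nat.pow_le_pow_right (by norm_num) hi
  set I := Finset.Ico (2 ^ i + 1) (2 ^ (i + 1)) with hI
  have h1 : ∑ j ∈ I, a j ≤ S := by
    refine Finset.sum_le_sum_of_subset_of_nonneg (fun j hj => ?_) fun j _ _ => ha0 j
    rw [hI, Finset.mem_Ico] at hj
    rw [dyadicBlock, Finset.mem_Ioc]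
    omega
  have h2 : ∑ j ∈ I, a (j + 1) ≤ S := by
    rw [hI, Finset.sum_Ico_add']
    refine Finset.sum_le_sum_of_subset_of_nonneg (fun j hj => ?_) fun j _ _ => ha0 j
    rw [Finset.mem_Ico] at hj
    rw [dyadicBlock, Finset.mem_Ioc]
    omega
  have h3 : ∑ _j ∈ I, ‖(z : ℂ) - 1‖ ≤ ∑ j ∈ I, (a (j + 1) + 2 ^ (i + 1) * a j) := by
    refine Finset.sum_le_sum fun j hj => (norm_sub_one_le_erdosTaylor z j).trans ?_
    have : (j : ℝ) ≤ 2 ^ (i + 1) := by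
      rw [hI, Finset.mem_Ico] at hj
      exact_mod_cast hj.2.le
    have := mul_le_mul_of_nonneg_right this (ha0 j)
    linarith
  rw [Finset.sum_const, Finset.sum_add_distrib, ← Finset.mul_sum, nsmul_eq_mul] at h3
  have hcard : (I.card : ℝ) = 2 ^ i - 1 := by
    rw [hI, Nat.card_Ico, hpow, Nat.cast_sub (by omega)]
    push_cast
    ring
  rw [hcard] at h3
  have hxr : (2 : ℝ) ≤ 2 ^ i := by exact_mod_cast hx
  have hS0 : 0 ≤ S := Finset.sum_nonneg fun j _ => ha0 j
  have h4 : ((2 : ℝ) ^ i - 1) * ‖(z : ℂ) - 1‖ ≤ (1 + 2 ^ (i + 1)) * S := by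
    have := mul_le_mul_of_nonneg_left h1 (show (0 : ℝ) ≤ 2 ^ (i + 1) by positivity)
    linarith
  -- The inequality 1 + 2x ≤ 5(x - 1) holds exactly for x ≥ 2, that is, for i ≥ 1.
  have h5 : (1 + 2 ^ (i + 1)) * S ≤ ((2 : ℝ) ^ i - 1) * (5 * S) := by
    rw [pow_succ]
    nlinarith
  exact le_of_mul_le_mul_left (h4.trans h5) (by linarith)

/-- While the products stay within 1/2 of 1 there is no winding, and each new factor at distance t
from 1 raises the imaginary part by at least (1/2)(9/10)t - t²/4 ≥ t/4, since t ≤ 1/2. -/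
lemma sum_norm_sub_one_le_im_prod {ι : Type*} (u : ι → ℂ) (hu : ∀ i, ‖u i‖ = 1) (H : Finset ι)
    (hH : ∀ K ⊆ H, ‖∏ i ∈ K, u i - 1‖ ≤ 1 / 2) (him : ∀ i ∈ H, 0 ≤ (u i).im) :
    (1 / 4) * ∑ i ∈ H, ‖u i - 1‖ ≤ (∏ i ∈ H, u i).im := by
  classical
  induction H using Finset.induction_on with
  | empty => simp
  | insert i H hi ih =>
    have ih' := ih (fun K hK => hH K (hK.trans (Finset.subset_insert _ _)))
      fun j hj => him j (Finset.mem_insert_of_mem hj)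
    have hU := hH H (Finset.subset_insert _ _)
    have ht := hH {i} (by simp)
    rw [Finset.prod_singleton] at ht
    rw [Finset.sum_insert hi, Finset.prod_insert hi, Complex.mul_im]
    set U := ∏ i ∈ H, u i
    have hy := him i (Finset.mem_insert_self _ _)
    set t := ‖u i - 1‖ with htdef
    have ht0 : 0 ≤ t := norm_nonneg _
    have e1 : (u i).re ^ 2 + (u i).im ^ 2 = 1 := by
      have := Complex.sq_norm (u i)
      rw [hu, Complex.normSq_apply] at this
      linarith
    have e2 : t ^ 2 = 2 - 2 * (u i).re := by
      rw [htdef, Complex.sq_norm, Complex.normSq_apply]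
      simp only [Complex.sub_re, Complex.sub_im, Complex.one_re, Complex.one_im]
      linarith
    have hx : (u i).re = 1 - t ^ 2 / 2 := by linarith
    have e3 : (9 / 10 * t) ^ 2 ≤ (u i).im ^ 2 := by
      rw [hx] at e1
      have : t ^ 2 ≤ 1 / 4 := by nlinarith
      nlinarith
    have e4 : 9 / 10 * t ≤ (u i).im := by
      exact (sq_le_sq₀ (by positivity) hy).1 e3
    have h1 := (Complex.abs_re_le_norm (U - 1)).trans hU
    have h2 := (Complex.abs_im_le_norm (U - 1)).trans hU
    simp only [Complex.sub_re, Complex.sub_im, Complex.one_re, Complex.one_im, sub_zero] at h1 h2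
    rw [abs_le] at h1 h2
    have h3 : 1 / 2 * (9 / 10 * t) ≤ U.re * (u i).im := by
      have : 1 / 2 ≤ U.re := by linarith [h1.1]
      gcongr
    rw [hx]
    nlinarith [mul_le_mul_of_nonneg_right h2.2 (sq_nonneg t), mul_le_mul_of_nonneg_left ht ht0]

/-- If every subproduct were close to 1, split the factors by the sign of the imaginary part,
conjugating the negative ones: within each class the rotations add up, and one class carries at
least half of the total. -/
lemma exists_subset_prod_sub_one_ge {ι : Type*} (s : Finset ι) (u : ι → ℂ)
    (hu : ∀ i, ‖u i‖ = 1) :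
    ∃ G ⊆ s, min (1 / 2) ((∑ i ∈ s, ‖u i - 1‖) / 8) ≤ ‖∏ i ∈ G, u i - 1‖ := by
  classical
  by_contra! hcon
  have hhalf : ∀ K ⊆ s, ‖∏ i ∈ K, u i - 1‖ ≤ 1 / 2 := fun K hK =>
    ((hcon K hK).trans_le (min_le_left _ _)).le
  set P := s.filter fun i => 0 ≤ (u i).im
  set N := s.filter fun i => ¬ 0 ≤ (u i).im
  have hPs : P ⊆ s := Finset.filter_subset _ _
  have hNs : N ⊆ s := Finset.filter_subset _ _
  have hP := sum_norm_sub_one_le_im_prod u hu P (fun K hK => hhalf K (hK.trans hPs))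
    fun i hi => (Finset.mem_filter.1 hi).2
  have hconj : ∀ i, ‖starRingEnd ℂ (u i) - 1‖ = ‖u i - 1‖ := fun i => by
    rw [← RCLike.norm_conj (u i - 1), map_sub, map_one]
  have hN := sum_norm_sub_one_le_im_prod (fun i => starRingEnd ℂ (u i))
    (fun i => by rw [RCLike.norm_conj, hu]) N (fun K hK => by
      rw [← map_prod, ← RCLike.norm_conj, map_sub, map_one, RCLike.conj_conj]
      exact hhalf K (hK.trans hNs))
    (fun i hi => by
      have := (Finset.mem_filter.1 hi).2
      simp only [Complex.conj_im]
      linarith)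
  simp only [hconj] at hN
  rw [← map_prod, Complex.conj_im] at hN
  have hsum : ∑ i ∈ P, ‖u i - 1‖ + ∑ i ∈ N, ‖u i - 1‖ = ∑ i ∈ s, ‖u i - 1‖ :=
    Finset.sum_filter_add_sum_filter_not _ _ _
  have h1 := (hcon P hPs).trans_le (min_le_right _ _)
  have h2 := (hcon N hNs).trans_le (min_le_right _ _)
  have h3 := (le_abs_self _).trans (Complex.abs_im_le_norm (∏ i ∈ P, u i - 1))
  have h4 := (neg_le_abs _).trans (Complex.abs_im_le_norm (∏ i ∈ N, u i - 1))
  simp only [Complex.sub_im, Complex.one_im, sub_zero] at h3 h4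
  linarith

/-- Every dyadic block contains a set of indices whose Erdős–Taylor sum moves `z` away from `1`. -/
lemma exists_subset_dyadicBlock (z : Circle) {i : ℕ} (hi : 1 ≤ i) :
    ∃ G ⊆ dyadicBlock i, ‖(z : ℂ) - 1‖ / 40 ≤ ‖(z : ℂ) ^ (∑ j ∈ G, erdosTaylor j) - 1‖ := by
  obtain ⟨G, hG, h⟩ := exists_subset_prod_sub_one_ge (dyadicBlock i)
    (fun j => (z : ℂ) ^ erdosTaylor j) fun j => by rw [norm_pow, Circle.norm_coe, one_pow]
  refine ⟨G, hG, le_trans (le_min ?_ ?_) (by rwa [Finset.prod_pow_eq_pow_sum] at h)⟩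
  -- The constant is 40 = 5 · 8; the cap 1/2 is harmless because |z - 1| ≤ 2.
  · have := norm_sub_le (z : ℂ) 1
    rw [Circle.norm_coe, norm_one] at this
    linarith
  · linarith [norm_sub_one_le_sum_dyadicBlock z hi]

/-! ### Density in the Bohr compactification -/

lemma dyadicBlock_disjoint {i j : ℕ} (h : i < j) : Disjoint (dyadicBlock i) (dyadicBlock j) := by
  rw [Finset.disjoint_left]
  intro x hx hy
  rw [dyadicBlock, Finset.mem_Ioc] at hx hy
  have : 2 ^ (i + 1) ≤ 2 ^ j := Nat.pow_le_pow_right (by norm_num) h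
  omega

lemma sum_mem_subsetSums {q : ℕ → ℕ} {l : ℕ} {B : Finset ℕ}
    (hB : B ⊆ Finset.Ico (q l) (q (l + 1))) {G : ℕ → Finset ℕ} (hG : ∀ i ∈ B, G i ⊆ dyadicBlock i) :
    ∑ i ∈ B, ∑ j ∈ G i, erdosTaylor j ∈ subsetSums (blockUnion q l) := by
  refine ⟨B.biUnion G, ?_, ?_⟩
  · intro j hj
    obtain ⟨i, hi, hij⟩ := Finset.mem_biUnion.1 hj
    exact Finset.mem_biUnion.2 ⟨i, hB hi, hG i hi hij⟩
  · refine (Finset.sum_biUnion fun i hi j hj hij => ?_).symm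
    rcases lt_or_gt_of_ne hij with h | h
    · exact Finset.disjoint_of_subset_left (hG i hi)
        (Finset.disjoint_of_subset_right (hG j hj) (dyadicBlock_disjoint h))
    · exact Finset.disjoint_of_subset_left (hG i hi)
        (Finset.disjoint_of_subset_right (hG j hj) (dyadicBlock_disjoint h).symm)

lemma prod_Ico_le_pow {f : ℕ → ℝ} (h0 : ∀ i, 0 ≤ f i) (h1 : ∀ i, f i ≤ 1) {ρ : ℝ} {a M : ℕ}
    (hw : ∀ a' ≥ a, ∃ i ∈ Finset.Ico a' (a' + M), f i ≤ ρ) (K : ℕ) {b : ℕ}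
    (hb : a + K * M ≤ b) : ∏ i ∈ Finset.Ico a b, f i ≤ ρ ^ K := by
  have hρ : 0 ≤ ρ := by
    obtain ⟨i, -, hi⟩ := hw a le_rfl
    exact (h0 i).trans hi
  induction K generalizing b with
  | zero => simpa using Finset.prod_le_one (fun i _ => h0 i) fun i _ => h1 i
  | succ K ih =>
    have hM : a + (K + 1) * M = a + K * M + M := by ring
    rw [← Finset.prod_Ico_consecutive f (show a ≤ a + K * M by omega) (by omega), pow_succ]
    refine mul_le_mul (ih le_rfl) ?_ (Finset.prod_nonneg fun i _ => h0 i) (by positivity)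
    obtain ⟨i, hi, hfi⟩ := hw (a + K * M) (by omega)
    have hi' : i ∈ Finset.Ico (a + K * M) b := by
      rw [Finset.mem_Ico] at hi ⊢
      omega
    rw [← Finset.mul_prod_erase _ _ hi']
    exact (mul_le_of_le_one_right (h0 i)
      (Finset.prod_le_one (fun j _ => h0 j) fun j _ => h1 j)).trans hfi

lemma norm_one_add_div_two_sq (w : Circle) :
    ‖(1 + (w : ℂ)) / 2‖ ^ 2 = 1 - ‖(w : ℂ) - 1‖ ^ 2 / 4 := by
  have h : (w : ℂ).re * (w : ℂ).re + (w : ℂ).im * (w : ℂ).im = 1 := by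
    rw [← Complex.normSq_apply, Circle.normSq_coe]
  rw [norm_div, div_pow, Complex.norm_ofNat, Complex.sq_norm, Complex.sq_norm,
    Complex.normSq_apply, Complex.normSq_apply]
  simp only [Complex.add_re, Complex.add_im, Complex.sub_re, Complex.sub_im, Complex.one_re,
    Complex.one_im]
  linear_combination (1 / 2 : ℝ) * h

lemma norm_one_add_div_two_le_one (w : Circle) : ‖(1 + (w : ℂ)) / 2‖ ≤ 1 := by
  have := norm_one_add_div_two_sq w
  have h2 : ‖(1 + (w : ℂ)) / 2‖ ^ 2 ≤ 1 ^ 2 := by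
    rw [this]
    linarith [sq_nonneg ‖(w : ℂ) - 1‖]
  exact (sq_le_sq₀ (norm_nonneg _) zero_le_one).1 h2

/-- Finitely many nontrivial characters can be made to have small averages over a family of subset
sums. -/
lemma exists_family_average_small {q : ℕ → ℕ} (hq : StrictMono q)
    (hN : Tendsto (fun l => q (l + 1) - q l) atTop atTop) (Λ : Finset Circle) (hΛ : 1 ∉ Λ)
    {δ : ℝ} (hδ : 0 < δ) :
    ∃ (𝓑 : Finset (Finset ℕ)) (s : Finset ℕ → ℕ), 𝓑.Nonempty ∧
      (∀ B ∈ 𝓑, s B ∈ erdosTaylorSums q) ∧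
      ∀ z ∈ Λ, ‖∑ B ∈ 𝓑, (z : ℂ) ^ s B‖ ≤ δ * 𝓑.card := by
  rcases Λ.eq_empty_or_nonempty with rfl | hne
  · exact ⟨{∅}, fun _ => 0, by simp,
      fun B _ => Set.mem_iUnion.2 ⟨0, ∅, by simp, by simp⟩, by simp⟩
  obtain ⟨η, hη, hηΛ⟩ : ∃ η > 0, ∀ z ∈ Λ, η ≤ ‖(z : ℂ) - 1‖ / 40 := by
    obtain ⟨z₀, hz₀, hmin⟩ := Λ.exists_min_image (fun z => ‖(z : ℂ) - 1‖ / 40) hne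
    refine ⟨_, ?_, hmin⟩
    have : (z₀ : ℂ) - 1 ≠ 0 := by
      rw [sub_ne_zero]
      intro h
      exact hΛ (Circle.coe_eq_one.1 h ▸ hz₀)
    positivity
  set M := Λ.card with hM
  have hM0 : 0 < M := hne.card_pos
  -- The blocks are assigned to the elements of Λ cyclically, so any M consecutive blocks serve
  -- every element.
  let lam : ℕ → Circle := fun i => (Λ.equivFin.symm ⟨i % M, Nat.mod_lt _ hM0⟩ : Circle)
  have hlam : ∀ i, lam i ∈ Λ := fun i => (Λ.equivFin.symm _).2
  have hwin : ∀ z ∈ Λ, ∀ a, ∃ i ∈ Finset.Ico a (a + M), lam i = z := by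
    intro z hz a
    have h1 : ((Λ.equivFin ⟨z, hz⟩ : Fin M) : ℕ) ∈ Finset.range M :=
      Finset.mem_range.2 (Λ.equivFin ⟨z, hz⟩).2
    rw [← Nat.image_Ico_mod a M, Finset.mem_image] at h1
    obtain ⟨i, hi, him⟩ := h1
    refine ⟨i, hi, ?_⟩
    have : (⟨i % M, Nat.mod_lt _ hM0⟩ : Fin M) = Λ.equivFin ⟨z, hz⟩ := Fin.ext him
    change ((Λ.equivFin.symm ⟨i % M, Nat.mod_lt _ hM0⟩ : Λ) : Circle) = z
    rw [this, Equiv.symm_apply_apply]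
  have hG : ∀ i, ∃ G ⊆ dyadicBlock i, 1 ≤ i →
      ‖(lam i : ℂ) - 1‖ / 40 ≤ ‖(lam i : ℂ) ^ (∑ j ∈ G, erdosTaylor j) - 1‖ := by
    intro i
    by_cases hi : 1 ≤ i
    · obtain ⟨G, hG, h⟩ := exists_subset_dyadicBlock (lam i) hi
      exact ⟨G, hG, fun _ => h⟩
    · exact ⟨∅, by simp, fun h => absurd h hi⟩
  choose G hGs hGl using hG
  set w : ℕ → ℕ := fun i => ∑ j ∈ G i, erdosTaylor j with hw
  set ρ : ℝ := Real.sqrt (1 - η ^ 2 / 4) with hρ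
  have hρ1 : ρ < 1 := by
    rw [hρ, Real.sqrt_lt' one_pos]
    have : 0 < η ^ 2 := by positivity
    linarith
  obtain ⟨K, hK⟩ := exists_pow_lt_of_lt_one hδ hρ1
  -- `K * M` blocks give each element K factors of modulus at most ρ; l ≥ 1 excludes the block of
  -- index 0, where the lower bound is not available.
  obtain ⟨l, hl, hl1⟩ := ((hN.eventually_ge_atTop (K * M)).and (eventually_ge_atTop 1)).exists
  have hql : 1 ≤ q l := hl1.trans hq.le_apply
  set a := q l with ha
  set b := q (l + 1) with hb
  have hab : a + K * M ≤ b := by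
    have : a < b := hq (Nat.lt_succ_self l)
    omega
  refine ⟨(Finset.Ico a b).powerset, fun B => ∑ i ∈ B, w i, ⟨∅, by simp⟩, fun B hB => ?_,
    fun z hz => ?_⟩
  · exact Set.mem_iUnion.2 ⟨l, sum_mem_subsetSums (Finset.mem_powerset.1 hB) fun i _ => hGs i⟩
  -- The sum over all subsets factors as ∏ (1 + z ^ w_i).
  · simp only [← Finset.prod_pow_eq_pow_sum]
    rw [← Finset.prod_one_add, Finset.card_powerset]
    have h1 : ∏ i ∈ Finset.Ico a b, (1 + (z : ℂ) ^ w i) =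
        (∏ i ∈ Finset.Ico a b, (1 + (z : ℂ) ^ w i) / 2) * 2 ^ (Finset.Ico a b).card := by
      rw [Finset.prod_div_distrib, Finset.prod_const, div_mul_cancel₀]
      exact pow_ne_zero _ two_ne_zero
    rw [h1, norm_mul, norm_pow, Complex.norm_ofNat, Nat.cast_pow, Nat.cast_ofNat]
    gcongr
    rw [norm_prod]
    refine (prod_Ico_le_pow (fun i => norm_nonneg _) (fun i => ?_) (fun a' ha' => ?_) K hab).trans
      hK.le
    · have := norm_one_add_div_two_le_one (z ^ w i)
      rwa [Circle.coe_pow] at this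
    · obtain ⟨i, hi, hiz⟩ := hwin z hz a'
      refine ⟨i, hi, ?_⟩
      refine Real.le_sqrt_of_sq_le ?_
      have h2 := norm_one_add_div_two_sq (z ^ w i)
      rw [Circle.coe_pow] at h2
      rw [h2]
      have h3 := hGl i (by have := (Finset.mem_Ico.1 hi).1; omega)
      rw [hiz] at h3
      have h4 := (hηΛ z hz).trans h3
      gcongr

/-- This chooses the degree N of the peaked polynomial: its decay away from the peak must beat the
number (N + 1) ^ r of its monomials. -/
lemma exists_pow_mul_lt_inv (r : ℕ) {x : ℝ} (hx0 : 0 ≤ x) (hx1 : x < 1) :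
    ∃ N : ℕ, x ^ N * ((N + 1 : ℕ) : ℝ) ^ r < 1 / 2 := by
  have h := (tendsto_pow_const_mul_const_pow_of_abs_lt_one r (r := x)
    (by rwa [abs_of_nonneg hx0])).const_mul (2 ^ r)
  rw [mul_zero] at h
  obtain ⟨N, hN, hN1⟩ := ((h.eventually_lt_const (show (0 : ℝ) < 1 / 2 by norm_num)).and
    (eventually_ge_atTop 1)).exists
  refine ⟨N, lt_of_le_of_lt ?_ hN⟩
  have hN1' : (1 : ℝ) ≤ N := by exact_mod_cast hN1
  rw [mul_comm, ← mul_assoc, ← mul_pow]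
  gcongr
  push_cast
  linarith

/-- The expansion of a product of binomial powers along a homomorphism. -/
lemma prod_one_add_div_two_pow {ι : Type*} [Fintype ι] [DecidableEq ι] (N : ℕ) (z : ι → Circle)
    (ψ : Circle →* Circle) :
    ∏ i, ((1 + (ψ (z i) : ℂ)) / 2) ^ N =
      ∑ k : ι → Fin (N + 1), ((∏ i, (N.choose (k i) : ℝ) / 2 ^ N : ℝ) : ℂ) *
        (ψ (∏ i, z i ^ (k i : ℕ)) : ℂ) := by
  have h1 : ∀ i, ((1 + (ψ (z i) : ℂ)) / 2) ^ N =
      ∑ j : Fin (N + 1), ((N.choose j : ℂ) / 2 ^ N) * (ψ (z i) : ℂ) ^ (j : ℕ) := by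
    intro i
    rw [div_pow, add_comm, add_pow, Finset.sum_range, Finset.sum_div]
    refine Finset.sum_congr rfl fun j _ => ?_
    rw [one_pow]
    ring
  rw [Finset.prod_congr rfl fun i _ => h1 i, Fintype.prod_sum]
  refine Finset.sum_congr rfl fun k _ => ?_
  rw [Finset.prod_mul_distrib]
  congr 1
  · push_cast; rfl
  · have h2 := map_prod Circle.coeHom (fun x => ψ (z x) ^ (k x : ℕ)) Finset.univ
    rw [map_prod]
    simp only [map_pow] at h2 ⊢
    exact h2.symm

/-- The `n`-th power homomorphism of the circle, twisted by the inverse of `χ`. -/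
def twistedPow (χ : Circle →* Circle) (n : ℕ) : Circle →* Circle := powMonoidHom n * χ⁻¹

lemma twistedPow_apply (χ : Circle →* Circle) (n : ℕ) (z : Circle) :
    twistedPow χ n z = z ^ n * (χ z)⁻¹ := rfl

lemma norm_twistedPow_sub_one (χ : Circle →* Circle) (n : ℕ) (z : Circle) :
    ‖(twistedPow χ n z : ℂ) - 1‖ = ‖(z : ℂ) ^ n - χ z‖ := by
  have h : (z : ℂ) ^ n - χ z = ((twistedPow χ n z : ℂ) - 1) * χ z := by
    rw [twistedPow_apply, Circle.coe_mul, Circle.coe_inv, Circle.coe_pow, sub_mul, mul_assoc,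
      inv_mul_cancel₀ (Circle.coe_ne_zero _), mul_one, one_mul]
  rw [h, norm_mul, Circle.norm_coe, mul_one]

/-- The set `D` approximates every homomorphism of the circle on every finite set. -/
theorem exists_mem_erdosTaylorSums_near {q : ℕ → ℕ} (hq : StrictMono q)
    (hN : Tendsto (fun l => q (l + 1) - q l) atTop atTop) {ι : Type*} [Fintype ι]
    (z : ι → Circle) (χ : Circle →* Circle) {ε : ℝ} (hε : 0 < ε) :
    ∃ n ∈ erdosTaylorSums q, ∀ i, ‖(z i : ℂ) ^ n - χ (z i)‖ < ε := by
  classical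
  by_contra! hcon
  have hε2 : ε ≤ 2 := by
    -- The empty sum 0 belongs to D; it gives ε ≤ 2, so that x below is nonnegative.
    obtain ⟨i, hi⟩ := hcon 0 (Set.mem_iUnion.2 ⟨0, ∅, by simp, by simp⟩)
    refine hi.trans ((norm_sub_le _ _).trans ?_)
    rw [norm_pow, Circle.norm_coe, Circle.norm_coe]
    norm_num
  set x : ℝ := 1 - ε ^ 2 / 4 with hx
  have hx0 : 0 ≤ x := by nlinarith
  have hx1 : x < 1 := by
    have : 0 < ε ^ 2 := by positivity
    linarith
  obtain ⟨N, hN'⟩ := exists_pow_mul_lt_inv (Fintype.card ι) hx0 hx1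
  let κ := ι → Fin (N + 1)
  let b : κ → ℝ := fun k => ∏ i, (N.choose (k i) : ℝ) / 2 ^ N
  let Mon : κ → Circle := fun k => ∏ i, z i ^ (k i : ℕ)
  have hb0 : ∀ k, 0 ≤ b k := fun k => Finset.prod_nonneg fun i _ => by positivity
  have hexp : ∀ ψ : Circle →* Circle, ∏ i, ((1 + (ψ (z i) : ℂ)) / 2) ^ N =
      ∑ k, (b k : ℂ) * (ψ (Mon k) : ℂ) := fun ψ => prod_one_add_div_two_pow N z ψ
  -- Evaluate the expansion at the trivial homomorphism.
  have hb1 : ∑ k, b k = 1 := by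
    have := hexp 1
    simp only [MonoidHom.one_apply, Circle.coe_one, mul_one] at this
    norm_num at this
    exact_mod_cast this.symm
  set C : ℝ := ((N + 1 : ℕ) : ℝ) ^ Fintype.card ι with hC
  have hC0 : 0 < C := by positivity
  have hκ : (Fintype.card κ : ℝ) = C := by
    rw [hC, Fintype.card_fun, Fintype.card_fin, Nat.cast_pow]
  have hbsq : 1 ≤ C * ∑ k, b k ^ 2 := by
    have := sq_sum_le_card_mul_sum_sq (s := (Finset.univ : Finset κ)) (f := b)
    rwa [hb1, one_pow, Finset.card_univ, hκ] at this
  -- These are the nontrivial characters in the expansion of |P|². Their total weight is at most 1,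
  -- so averages at most 1/(2C) leave half of the lower bound 1/C for ∑ b_k².
  set Λ : Finset Circle :=
    ((Finset.univ : Finset (κ × κ)).image fun p => Mon p.1 * (Mon p.2)⁻¹).erase 1 with hΛ
  obtain ⟨𝓑, s, hne, hs, hsmall⟩ := exists_family_average_small hq hN Λ (Finset.notMem_erase _ _)
    (show 0 < 1 / (2 * C) by positivity)
  have hcard : (0 : ℝ) < 𝓑.card := by exact_mod_cast hne.card_pos
  let P : ℕ → ℂ := fun n => ∏ i, ((1 + (twistedPow χ n (z i) : ℂ)) / 2) ^ N
  have hPle : ∀ B ∈ 𝓑, ‖P (s B)‖ ^ 2 ≤ x ^ N := by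
    intro B hB
    obtain ⟨i, hi⟩ := hcon (s B) (hs B hB)
    rw [← norm_twistedPow_sub_one] at hi
    simp only [P]
    rw [norm_prod, ← Finset.prod_pow, ← Finset.mul_prod_erase _ _ (Finset.mem_univ i)]
    have h1 : ∀ j, ‖((1 + (twistedPow χ (s B) (z j) : ℂ)) / 2) ^ N‖ ^ 2 ≤ 1 := fun j => by
      rw [norm_pow]
      exact pow_le_one₀ (by positivity)
        (pow_le_one₀ (norm_nonneg _) (norm_one_add_div_two_le_one _))
    refine (mul_le_of_le_one_right (by positivity)
      (Finset.prod_le_one (fun j _ => by positivity) fun j _ => h1 j)).trans ?_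
    rw [norm_pow, ← pow_mul, mul_comm, pow_mul, norm_one_add_div_two_sq]
    have h2 : ε ^ 2 ≤ ‖(twistedPow χ (s B) (z i) : ℂ) - 1‖ ^ 2 := by gcongr
    refine pow_le_pow_left₀ ?_ (by linarith) N
    rw [← norm_one_add_div_two_sq]
    positivity
  have hPsq : ∀ n, ((‖P n‖ ^ 2 : ℝ) : ℂ) = ∑ k, ∑ k', ((b k * b k' : ℝ) : ℂ) *
      (twistedPow χ n (Mon k * (Mon k')⁻¹) : ℂ) := by
    intro n
    have h1 : P n = ∑ k, (b k : ℂ) * (twistedPow χ n (Mon k) : ℂ) := hexp _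
    have h2 : ((‖P n‖ ^ 2 : ℝ) : ℂ) = P n * starRingEnd ℂ (P n) := by
      rw [RCLike.mul_conj]; push_cast; rfl
    rw [h2, h1, map_sum, Finset.sum_mul_sum]
    refine Finset.sum_congr rfl fun k _ => Finset.sum_congr rfl fun k' _ => ?_
    rw [map_mul, map_mul, map_inv, Circle.coe_mul, Circle.coe_inv_eq_conj, Complex.conj_ofReal]
    push_cast
    ring
  -- Distinct exponents may give the same monomial when the z_i satisfy relations; such coincidences
  -- only add nonnegative terms.
  have hterm : ∀ k k', (if k = k' then (𝓑.card : ℝ) else 0) - 1 / (2 * C) * 𝓑.card ≤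
      (∑ B ∈ 𝓑, (twistedPow χ (s B) (Mon k * (Mon k')⁻¹) : ℂ)).re := by
    intro k k'
    by_cases hkk : Mon k * (Mon k')⁻¹ = 1
    · rw [hkk]
      simp only [map_one, Circle.coe_one, Finset.sum_const, nsmul_eq_mul, mul_one,
        Complex.natCast_re]
      have : 0 ≤ 1 / (2 * C) * 𝓑.card := by positivity
      split_ifs <;> linarith
    · have hk : k ≠ k' := fun h => hkk (by rw [h, mul_inv_cancel])
      rw [if_neg hk, zero_sub]
      have hmem : Mon k * (Mon k')⁻¹ ∈ Λ :=
        Finset.mem_erase.2 ⟨hkk, Finset.mem_image.2 ⟨(k, k'), Finset.mem_univ _, rfl⟩⟩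
      have h1 := hsmall _ hmem
      have h2 : ‖∑ B ∈ 𝓑, (twistedPow χ (s B) (Mon k * (Mon k')⁻¹) : ℂ)‖ =
          ‖∑ B ∈ 𝓑, ((Mon k * (Mon k')⁻¹ : Circle) : ℂ) ^ s B‖ := by
        simp only [twistedPow_apply, Circle.coe_mul _ (χ _)⁻¹, Circle.coe_pow]
        rw [← Finset.sum_mul, norm_mul, Circle.norm_coe, mul_one]
      rw [← h2] at h1
      have h3 := (abs_le.1 (Complex.abs_re_le_norm
        (∑ B ∈ 𝓑, (twistedPow χ (s B) (Mon k * (Mon k')⁻¹) : ℂ)))).1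
      linarith
  have hlower : (𝓑.card : ℝ) * (∑ k, b k ^ 2) - 1 / (2 * C) * 𝓑.card ≤ ∑ B ∈ 𝓑, ‖P (s B)‖ ^ 2 := by
    have h1 : ((∑ B ∈ 𝓑, ‖P (s B)‖ ^ 2 : ℝ) : ℂ) = ∑ k, ∑ k', ((b k * b k' : ℝ) : ℂ) *
        ∑ B ∈ 𝓑, (twistedPow χ (s B) (Mon k * (Mon k')⁻¹) : ℂ) := by
      rw [Complex.ofReal_sum, Finset.sum_congr rfl fun B _ => hPsq (s B), Finset.sum_comm]
      refine Finset.sum_congr rfl fun k _ => ?_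
      rw [Finset.sum_comm]
      refine Finset.sum_congr rfl fun k' _ => ?_
      rw [Finset.mul_sum]
    have h2 := congrArg Complex.re h1
    rw [Complex.ofReal_re] at h2
    rw [h2]
    simp only [Complex.re_sum, Complex.re_ofReal_mul]
    have h3 : ∑ k, ∑ k', (b k * b k') * ((if k = k' then (𝓑.card : ℝ) else 0) -
        1 / (2 * C) * 𝓑.card) = 𝓑.card * (∑ k, b k ^ 2) - 1 / (2 * C) * 𝓑.card := by
      simp only [mul_sub, Finset.sum_sub_distrib, ← Finset.sum_mul, ← Finset.mul_sum, hb1, mul_one,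
        one_mul]
      rw [Finset.mul_sum]
      congr 1
      refine Finset.sum_congr rfl fun k _ => ?_
      rw [Finset.sum_eq_single k (fun k' _ h => by rw [if_neg h.symm, mul_zero]) (by simp),
        if_pos rfl]
      ring
    rw [← h3]
    refine Finset.sum_le_sum fun k _ => Finset.sum_le_sum fun k' _ =>
      mul_le_mul_of_nonneg_left ?_ (mul_nonneg (hb0 k) (hb0 k'))
    have := hterm k k'
    rwa [Complex.re_sum] at this
  have hupper : ∑ B ∈ 𝓑, ‖P (s B)‖ ^ 2 ≤ 𝓑.card * x ^ N := by
    rw [← nsmul_eq_mul]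
    exact Finset.sum_le_card_nsmul _ _ _ hPle
  have h1 : 𝓑.card * ((∑ k, b k ^ 2) - 1 / (2 * C)) ≤ 𝓑.card * x ^ N := by linarith
  have h2 := le_of_mul_le_mul_left h1 hcard
  have h3 : C * (1 / (2 * C)) = 1 / 2 := by field_simp
  have h4 := mul_le_mul_of_nonneg_left h2 hC0.le
  rw [mul_sub, h3] at h4
  linarith [mul_comm C (x ^ N)]

theorem isBohrDense_erdosTaylorSums {q : ℕ → ℕ} (hq : StrictMono q)
    (hN : Tendsto (fun l => q (l + 1) - q l) atTop atTop) :
    IsBohrDense ((fun n : ℕ => (n : ℤ)) '' erdosTaylorSums q) := by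
  intro χ
  rw [mem_closure_iff_nhds]
  intro U hU
  change U ∈ @nhds BohrZ (TopologicalSpace.induced _ _) χ at hU
  rw [nhds_induced, Filter.mem_comap] at hU
  obtain ⟨V, hV, hVU⟩ := hU
  rw [nhds_pi, Filter.mem_pi] at hV
  obtain ⟨I, hI, t, ht, htV⟩ := hV
  have := hI.fintype
  choose r hr hrt using fun i => Metric.mem_nhds_iff.1 (ht i)
  obtain ⟨ε, hε, hεr⟩ : ∃ ε > 0, ∀ i ∈ I, ε ≤ r i := by
    rcases I.eq_empty_or_nonempty with rfl | hne
    · exact ⟨1, one_pos, by simp⟩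
    · obtain ⟨i₀, hi₀, hmin⟩ := I.exists_min_image r hI hne
      exact ⟨r i₀, hr i₀, hmin⟩
  obtain ⟨n, hn, hnear⟩ := exists_mem_erdosTaylorSums_near hq hN (fun i : I => (i : Circle)) χ hε
  refine ⟨BohrZ.ofInt n, hVU (htV fun i hi => hrt i ?_), ⟨n, ⟨n, hn, rfl⟩, rfl⟩⟩
  rw [Metric.mem_ball]
  refine lt_of_lt_of_le ?_ (hεr i hi)
  have h1 := hnear ⟨i, hi⟩
  rw [← Circle.coe_pow, ← zpow_natCast] at h1
  change dist (((i ^ (n : ℤ) : Circle)) : ℂ) (χ.toFun i : ℂ) < ε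
  rw [dist_eq_norm]
  exact h1

/-! ### Factorial expansions along the Erdős–Taylor sequence -/

/-- If the increments of a are at most 1/(n+2)!, this makes a n + 2/(n+2)! nonincreasing, which
bounds the tails. -/
lemma factorial_tail_step (n : ℕ) :
    1 / ((n + 2).factorial : ℝ) + 2 / ((n + 3).factorial : ℝ) ≤ 2 / ((n + 2).factorial : ℝ) := by
  have h : ((n + 3).factorial : ℝ) = (n + 3) * (n + 2).factorial := by
    rw [Nat.factorial_succ (n + 2)]
    push_cast
    ring
  have hpos : (0 : ℝ) < (n + 2).factorial := by positivity
  rw [h, ← sub_nonneg]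
  have : 2 / ((n + 2).factorial : ℝ) - (1 / ((n + 2).factorial : ℝ) +
      2 / ((n + 3) * (n + 2).factorial)) = (n + 1) / ((n + 3) * (n + 2).factorial) := by
    field_simp
    ring
  rw [this]
  positivity

lemma limit_mem_of_factorial_steps {a : ℕ → ℝ} {L : ℝ} (h0 : ∀ n, a n ≤ a (n + 1))
    (h1 : ∀ n, a (n + 1) ≤ a n + 1 / ((n + 2).factorial : ℝ)) (hL : Tendsto a atTop (𝓝 L)) (n : ℕ) :
    a n ≤ L ∧ L ≤ a n + 2 / ((n + 2).factorial : ℝ) := by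
  have hmono : Monotone a := monotone_nat_of_le_succ h0
  refine ⟨hmono.ge_of_tendsto hL n, ?_⟩
  have hanti : Antitone fun n => a n + 2 / ((n + 2).factorial : ℝ) :=
    antitone_nat_of_succ_le fun n => by
      have := factorial_tail_step n
      have := h1 n
      change a (n + 1) + 2 / ((n + 3).factorial : ℝ) ≤ _
      linarith
  refine le_of_tendsto hL ?_
  filter_upwards [eventually_ge_atTop n] with k hk
  have h2 : a k + 2 / ((k + 2).factorial : ℝ) ≤ a n + 2 / ((n + 2).factorial : ℝ) := hanti hk
  have h3 : 0 ≤ 2 / ((k + 2).factorial : ℝ) := by positivity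
  linarith

lemma exists_tendsto_of_factorial_steps {a : ℕ → ℝ} (h0 : ∀ n, a n ≤ a (n + 1))
    (h1 : ∀ n, a (n + 1) ≤ a n + 1 / ((n + 2).factorial : ℝ)) : ∃ L, Tendsto a atTop (𝓝 L) := by
  have hanti : Antitone fun n => a n + 2 / ((n + 2).factorial : ℝ) :=
    antitone_nat_of_succ_le fun n => by
      have := factorial_tail_step n
      have := h1 n
      change a (n + 1) + 2 / ((n + 3).factorial : ℝ) ≤ _
      linarith
  refine ⟨_, tendsto_atTop_ciSup (monotone_nat_of_le_succ h0)
    ⟨a 0 + 2 / ((0 + 2).factorial : ℝ), ?_⟩⟩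
  rintro - ⟨n, rfl⟩
  have h2 : a n + 2 / ((n + 2).factorial : ℝ) ≤ a 0 + 2 / ((0 + 2).factorial : ℝ) :=
    hanti (Nat.zero_le n)
  have h3 : 0 ≤ 2 / ((n + 2).factorial : ℝ) := by positivity
  linarith

/-- The partial sums of the series of `e`. -/
def expPartialSum (j : ℕ) : ℝ := ∑ i ∈ Finset.range j, 1 / (i.factorial : ℝ)

lemma expPartialSum_succ (j : ℕ) :
    expPartialSum (j + 1) = expPartialSum j + 1 / (j.factorial : ℝ) :=
  Finset.sum_range_succ _ _

/-- Dividing the recursion by j! turns it into the partial sums of the series of e. -/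
lemma erdosTaylor_succ_eq (j : ℕ) :
    (erdosTaylor (j + 1) : ℝ) = j.factorial * expPartialSum (j + 1) := by
  induction j with
  | zero => simp [erdosTaylor, expPartialSum]
  | succ j ih =>
    rw [erdosTaylor, expPartialSum_succ (j + 1), Nat.factorial_succ]
    push_cast
    rw [ih]
    have : (j.factorial : ℝ) ≠ 0 := by positivity
    field_simp

lemma tendsto_expPartialSum : Tendsto expPartialSum atTop (𝓝 (Real.exp 1)) := by
  have h := (NormedSpace.expSeries_div_hasSum_exp (1 : ℝ)).tendsto_sum_nat
  rw [← Real.exp_eq_exp_ℝ] at h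
  exact h.congr fun n => by simp [expPartialSum]

lemma exp_one_sub_expPartialSum (n : ℕ) :
    expPartialSum (n + 2) ≤ Real.exp 1 ∧
      Real.exp 1 ≤ expPartialSum (n + 2) + 2 / ((n + 2).factorial : ℝ) := by
  refine limit_mem_of_factorial_steps (a := fun n => expPartialSum (n + 2)) (fun n => ?_)
    (fun n => ?_) (tendsto_expPartialSum.comp (tendsto_add_atTop_nat 2)) n
  · change expPartialSum (n + 2) ≤ expPartialSum ((n + 2) + 1)
    rw [expPartialSum_succ (n + 2)]
    have : 0 ≤ 1 / ((n + 2).factorial : ℝ) := by positivity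
    linarith
  · exact (expPartialSum_succ (n + 2)).le

/-- A sequence of partial sums `1 + ∑ d_n / (n + 2)!` with digits `0` or `1`. -/
structure IsDigitSum (T d : ℕ → ℝ) : Prop where
  zero : T 0 = 1
  succ : ∀ n, T (n + 1) = T n + d n / ((n + 2).factorial : ℝ)
  digit : ∀ n, d n = 0 ∨ d n = 1

namespace IsDigitSum

variable {T d : ℕ → ℝ}

lemma le_succ (h : IsDigitSum T d) (n : ℕ) : T n ≤ T (n + 1) := by
  rw [h.succ]
  have : 0 ≤ d n := by rcases h.digit n with h | h <;> rw [h]; exact zero_le_one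
  have : 0 ≤ d n / ((n + 2).factorial : ℝ) := by positivity
  linarith

lemma succ_le (h : IsDigitSum T d) (n : ℕ) : T (n + 1) ≤ T n + 1 / ((n + 2).factorial : ℝ) := by
  rw [h.succ]
  have : d n ≤ 1 := by rcases h.digit n with h | h <;> rw [h]; exact zero_le_one
  gcongr

lemma exists_int (h : IsDigitSum T d) (n : ℕ) : ∃ k : ℤ, ((n + 1).factorial : ℝ) * T n = k := by
  induction n with
  | zero => exact ⟨1, by simp [h.zero]⟩
  | succ n ih =>
    obtain ⟨k, hk⟩ := ih
    have h1 : ((n + 2).factorial : ℝ) * T (n + 1) = (n + 2) * k + d n := by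
      rw [h.succ, mul_add, mul_div_cancel₀ _ (by positivity), ← hk, Nat.factorial_succ (n + 1)]
      push_cast
      ring
    rcases h.digit n with hd | hd
    · exact ⟨(n + 2) * k, by rw [h1, hd]; push_cast; ring⟩
    · exact ⟨(n + 2) * k + 1, by rw [h1, hd]; push_cast; ring⟩

/-- Since (n+1)! T n is an integer, subtracting it from θ p_{n+2} changes nothing modulo 1. -/
lemma circle_pow_erdosTaylor (h : IsDigitSum T d) (θ : ℝ) (n : ℕ) :
    Circle.exp (2 * Real.pi * θ) ^ erdosTaylor (n + 2) =
      Circle.exp (2 * Real.pi * ((n + 1).factorial * (θ * expPartialSum (n + 2) - T n))) := by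
  obtain ⟨k, hk⟩ := h.exists_int n
  have h1 : 2 * Real.pi * (((n + 1).factorial : ℝ) * (θ * expPartialSum (n + 2) - T n)) =
      (erdosTaylor (n + 2) : ℝ) * (2 * Real.pi * θ) - k * (2 * Real.pi) := by
    rw [erdosTaylor_succ_eq, ← hk]
    ring
  rw [h1, Circle.exp_sub, Circle.exp_natCast_mul, Circle.exp_intCast_mul, Circle.exp_two_pi,
    one_zpow, div_one]

lemma limit_mem_Icc (h : IsDigitSum T d) {L : ℝ} (hL : Tendsto T atTop (𝓝 L)) (n : ℕ) :
    1 ≤ T n ∧ T n ≤ L ∧ L ≤ 2 := by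
  have h0 := limit_mem_of_factorial_steps h.le_succ h.succ_le hL 0
  have h1 := (monotone_nat_of_le_succ h.le_succ) (Nat.zero_le n)
  rw [h.zero] at h0 h1
  refine ⟨h1, (limit_mem_of_factorial_steps h.le_succ h.succ_le hL n).1, h0.2.trans ?_⟩
  norm_num [Nat.factorial]

/-- The residue of `θ` times an Erdős–Taylor number is the normalized centered digit up to a
quadratically small error. -/
lemma abs_residue_sub_le (h : IsDigitSum T d) {L : ℝ} (hL : Tendsto T atTop (𝓝 L)) (n : ℕ) :
    |(n + 1).factorial * (L / Real.exp 1 * expPartialSum (n + 2) - T n) -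
      (d n - T n / Real.exp 1) / (n + 2)| ≤ 3 / ((n : ℝ) + 2) ^ 2 := by
  obtain ⟨-, hTL, hL2⟩ := h.limit_mem_Icc hL n
  obtain ⟨hL1, -, -⟩ := h.limit_mem_Icc hL 0
  have hT := limit_mem_of_factorial_steps h.le_succ h.succ_le hL (n + 1)
  have hT' := limit_mem_of_factorial_steps h.le_succ h.succ_le hL n
  have hE := exp_one_sub_expPartialSum (n + 1)
  have he : (2 : ℝ) < Real.exp 1 := lt_trans (by norm_num) Real.exp_one_gt_d9
  have hL0 : 0 ≤ L := by linarith [(h.limit_mem_Icc hL 0).2.1]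
  set e := Real.exp 1 with hedef
  set N : ℝ := (n : ℝ) + 2 with hN
  have hN0 : 0 < N := by positivity
  set f : ℝ := ((n + 1).factorial : ℝ) with hf
  have hf0 : 0 < f := by positivity
  have hf1 : 1 ≤ f := by
    rw [hf]; exact_mod_cast Nat.one_le_iff_ne_zero.2 (Nat.factorial_ne_zero _)
  have hf2 : ((n + 2).factorial : ℝ) = N * f := by
    rw [Nat.factorial_succ (n + 1), hN, hf]; push_cast; ring
  have hf3 : ((n + 1 + 2).factorial : ℝ) = (N + 1) * (N * f) := by
    rw [← hf2, Nat.factorial_succ (n + 2), hN]; push_cast; ring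
  rw [h.succ, hf2, hf3] at hT
  rw [expPartialSum_succ (n + 2), hf2, hf3] at hE
  rw [hf2] at hT'
  set E := expPartialSum (n + 2)
  set θ := L / e with hθ
  have hθe : θ * e = L := div_mul_cancel₀ _ (by positivity)
  have hθ0 : 0 ≤ θ := by positivity
  have hθ1 : θ ≤ 1 := by rw [hθ, div_le_one (by positivity)]; linarith
  -- Here r and r' are the scaled tails of L and e after the current term, and v below is the cost
  -- of replacing θ by T n / e. The error is r - θ r' - v, with r, θ r' in [0, 2/N²] and v in [0,
  -- 1/N²].
  set r := f * (L - (T n + d n / (N * f))) with hr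
  set r' := f * (e - (E + 1 / (N * f))) with hr'
  have hbound : f * (2 / ((N + 1) * (N * f))) ≤ 2 / N ^ 2 := by
    rw [mul_div_assoc', div_le_div_iff₀ (by positivity) (by positivity)]
    have : 0 ≤ f * N := by positivity
    nlinarith
  have hr0 : 0 ≤ r := mul_nonneg hf0.le (by linarith)
  have hr1 : r ≤ 2 / N ^ 2 :=
    (mul_le_mul_of_nonneg_left (by linarith) hf0.le).trans hbound
  have hr0' : 0 ≤ r' := mul_nonneg hf0.le (by linarith)
  have hr1' : r' ≤ 2 / N ^ 2 :=
    (mul_le_mul_of_nonneg_left (by linarith) hf0.le).trans hbound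
  set v := (θ - T n / e) / N with hv
  have hv' : θ - T n / e = (L - T n) / e := by rw [hθ, sub_div]
  have hv0 : 0 ≤ v := by
    rw [hv, hv']
    have : 0 ≤ L - T n := by linarith
    positivity
  have hv1 : v ≤ 1 / N ^ 2 := by
    rw [hv, hv', div_div, div_le_div_iff₀ (by positivity) (by positivity)]
    have h1 : L - T n ≤ 2 / N := by
      have : 2 / (N * f) ≤ 2 / N := by
        gcongr
        exact le_mul_of_one_le_right hN0.le hf1
      linarith
    calc (L - T n) * N ^ 2 ≤ 2 / N * N ^ 2 := by gcongr
      _ = 2 * N := by field_simp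
      _ ≤ 1 * (e * N) := by nlinarith
  have hid : f * (θ * E - T n) - (d n - T n / e) / N = r - θ * r' - v := by
    rw [hr, hr', hv]
    have h1 : f * (d n / (N * f)) = d n / N := by field_simp
    have h2 : f * (1 / (N * f)) = 1 / N := by field_simp
    have h3 : f * (θ * E - T n) = (f * (d n / (N * f)) + f * (L - (T n + d n / (N * f)))) -
        θ * (f * (1 / (N * f)) + f * (e - (E + 1 / (N * f)))) := by
      rw [← hθe]; ring
    rw [h3, h1, h2]
    ring
  rw [hid]
  have h4 : θ * r' ≤ 2 / N ^ 2 := (mul_le_of_le_one_left hr0' hθ1).trans hr1'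
  have h5 : 0 ≤ θ * r' := by positivity
  have h6 : 3 / N ^ 2 = 2 / N ^ 2 + 1 / N ^ 2 := by ring
  rw [h6, abs_le]
  constructor <;> linarith [show 0 ≤ 1 / N ^ 2 by positivity]

end IsDigitSum

/-- Compare with the telescoping sum of 1/((n+1)(n+2)). -/
lemma sum_inv_sq_le (N : ℕ) (F : Finset ℕ) (hF : ∀ n ∈ F, N ≤ n) :
    ∑ n ∈ F, 1 / ((n : ℝ) + 2) ^ 2 ≤ 1 / ((N : ℝ) + 1) := by
  have key : ∀ M, N ≤ M → ∑ n ∈ Finset.Ico N M, 1 / ((n : ℝ) + 2) ^ 2 ≤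
      1 / ((N : ℝ) + 1) - 1 / ((M : ℝ) + 1) := by
    intro M hM
    induction M, hM using Nat.le_induction with
    | base => simp
    | succ M hM ih =>
      rw [Finset.sum_Ico_succ_top hM]
      have : 1 / ((M : ℝ) + 2) ^ 2 ≤ 1 / ((M : ℝ) + 1) - 1 / (((M + 1 : ℕ) : ℝ) + 1) := by
        push_cast
        have e : 1 / ((M : ℝ) + 1) - 1 / (M + 1 + 1) = 1 / ((M + 1) * (M + 2)) := by
          field_simp
          ring
        rw [e]
        gcongr
        nlinarith
      linarith
  have hsub : F ⊆ Finset.Ico N (max N (F.sup id + 1)) := fun n hn => by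
    have : n ≤ F.sup id := Finset.le_sup (f := id) hn
    exact Finset.mem_Ico.2 ⟨hF n hn, by omega⟩
  refine (Finset.sum_le_sum_of_subset_of_nonneg hsub fun _ _ _ => by positivity).trans
    ((key _ (le_max_left _ _)).trans ?_)
  have : (0 : ℝ) ≤ 1 / (((max N (F.sup id + 1) : ℕ) : ℝ) + 1) := by positivity
  linarith

lemma norm_circle_exp_sub_one_le (x : ℝ) : ‖(Circle.exp x : ℂ) - 1‖ ≤ |x| := by
  rw [Circle.coe_exp, mul_comm]
  exact Real.norm_exp_I_mul_ofReal_sub_one_le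

/-! ### A random factorial expansion with centered digits -/

/-- The uniform distribution on `[0, 1]`. -/
def uniformMeasure : Measure ℝ := volume.restrict (Set.Icc 0 1)

instance : IsProbabilityMeasure uniformMeasure := ⟨by simp [uniformMeasure]⟩

/-- A sequence of independent uniform random variables. -/
def uniformSeq : Measure (ℕ → ℝ) := Measure.infinitePi fun _ => uniformMeasure

instance : IsProbabilityMeasure uniformSeq := by unfold uniformSeq; infer_instance

/-- Resampling one coordinate preserves the product measure. -/
lemma measurePreserving_update_uniformSeq (j : ℕ) :
    MeasurePreserving (fun p : (ℕ → ℝ) × ℝ => Function.update p.1 j p.2)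
      (uniformSeq.prod uniformMeasure) uniformSeq := by
  have hmeas : Measurable fun p : (ℕ → ℝ) × ℝ => Function.update p.1 j p.2 := by
    refine measurable_pi_lambda _ fun i => ?_
    by_cases h : i = j
    · subst h; simpa using measurable_snd
    · simp only [Function.update_of_ne h]
      exact (measurable_pi_apply i).comp measurable_fst
  refine ⟨hmeas, Measure.eq_infinitePi _ fun s t ht => ?_⟩
  rw [Measure.map_apply hmeas (.pi s.countable_toSet fun i _ => ht i)]
  have hpre : (fun p : (ℕ → ℝ) × ℝ => Function.update p.1 j p.2) ⁻¹' Set.pi s t =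
      Set.pi (s.erase j : Finset ℕ) t ×ˢ (if j ∈ s then t j else Set.univ) := by
    ext ⟨ω, u⟩
    simp only [Set.mem_preimage, Set.mem_pi, Set.mem_prod, Finset.mem_coe, Finset.mem_erase]
    constructor
    · intro h
      refine ⟨fun i hi => by simpa [Function.update_of_ne hi.1] using h i hi.2, ?_⟩
      split_ifs with hj
      · simpa using h j hj
      · trivial
    · rintro ⟨h1, h2⟩ i hi
      by_cases hij : i = j
      · subst hij
        simpa [hi] using h2
      · simpa [Function.update_of_ne hij] using h1 i ⟨hij, hi⟩
  rw [hpre, Measure.prod_prod, uniformSeq, Measure.infinitePi_pi _ fun i _ => ht i]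
  by_cases hj : j ∈ s
  · rw [if_pos hj, Finset.prod_erase_mul _ _ hj]
  · rw [if_neg hj, measure_univ, mul_one, Finset.erase_eq_of_notMem hj]

/-- The partial sums of the random expansion: the next digit is `1` with conditional probability
`T / e`. -/
def randomSum : ℕ → (ℕ → ℝ) → ℝ
  | 0, _ => 1
  | n + 1, ω => randomSum n ω +
      (if ω n < randomSum n ω / Real.exp 1 then 1 else 0) / ((n + 2).factorial : ℝ)

/-- The digits of the random expansion. -/
def randomDigit (n : ℕ) (ω : ℕ → ℝ) : ℝ := if ω n < randomSum n ω / Real.exp 1 then 1 else 0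

/-- The conditionally centered digits of the random expansion. -/
def centeredDigit (n : ℕ) (ω : ℕ → ℝ) : ℝ := randomDigit n ω - randomSum n ω / Real.exp 1

lemma isDigitSum_random (ω : ℕ → ℝ) :
    IsDigitSum (fun n => randomSum n ω) fun n => randomDigit n ω where
  zero := rfl
  succ _ := rfl
  digit n := by unfold randomDigit; split_ifs <;> simp

lemma measurable_randomSum (n : ℕ) : Measurable (randomSum n) := by
  induction n with
  | zero => exact measurable_const
  | succ n ih =>
    refine ih.add (Measurable.div_const (Measurable.ite ?_ measurable_const measurable_const) _)
    exact measurableSet_lt (measurable_pi_apply n) (ih.div_const _)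

lemma measurable_randomDigit (n : ℕ) : Measurable (randomDigit n) :=
  Measurable.ite (measurableSet_lt (measurable_pi_apply n)
    ((measurable_randomSum n).div_const _)) measurable_const measurable_const

lemma measurable_centeredDigit (n : ℕ) : Measurable (centeredDigit n) :=
  (measurable_randomDigit n).sub ((measurable_randomSum n).div_const _)

/-- Adaptedness: the n-th partial sum depends only on the coordinates below n. -/
lemma randomSum_update {n j : ℕ} (h : n ≤ j) (ω : ℕ → ℝ) (u : ℝ) :
    randomSum n (Function.update ω j u) = randomSum n ω := by
  induction n with
  | zero => rfl
  | succ n ih =>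
    rw [randomSum, randomSum, ih (by omega), Function.update_of_ne (by omega)]

lemma centeredDigit_update {n j : ℕ} (h : n < j) (ω : ℕ → ℝ) (u : ℝ) :
    centeredDigit n (Function.update ω j u) = centeredDigit n ω := by
  rw [centeredDigit, centeredDigit, randomDigit, randomDigit, randomSum_update h.le,
    Function.update_of_ne (by omega)]

/-- The limit of the random expansion. -/
def randomLimit (ω : ℕ → ℝ) : ℝ := ⨆ n, randomSum n ω

lemma tendsto_randomSum (ω : ℕ → ℝ) :
    Tendsto (fun n => randomSum n ω) atTop (𝓝 (randomLimit ω)) := by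
  have h := isDigitSum_random ω
  obtain ⟨L, hL⟩ := exists_tendsto_of_factorial_steps h.le_succ h.succ_le
  refine tendsto_atTop_ciSup (monotone_nat_of_le_succ h.le_succ) ⟨L, ?_⟩
  rintro - ⟨n, rfl⟩
  exact (h.limit_mem_Icc hL n).2.1

lemma measurable_randomLimit : Measurable randomLimit :=
  measurable_of_tendsto_metrizable measurable_randomSum
    (tendsto_pi_nhds.2 fun ω => tendsto_randomSum ω)

lemma randomSum_div_mem (n : ℕ) (ω : ℕ → ℝ) :
    0 ≤ randomSum n ω / Real.exp 1 ∧ randomSum n ω / Real.exp 1 ≤ 1 := by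
  obtain ⟨h1, h2, h3⟩ := (isDigitSum_random ω).limit_mem_Icc (tendsto_randomSum ω) n
  have he : (2 : ℝ) < Real.exp 1 := lt_trans (by norm_num) Real.exp_one_gt_d9
  refine ⟨by positivity, ?_⟩
  rw [div_le_one (by positivity)]
  linarith

lemma abs_centeredDigit_le (n : ℕ) (ω : ℕ → ℝ) : |centeredDigit n ω| ≤ 1 := by
  obtain ⟨h1, h2⟩ := randomSum_div_mem n ω
  rw [centeredDigit, randomDigit, abs_le]
  split_ifs <;> constructor <;> linarith

lemma integrable_of_abs_le {Ω : Type*} [MeasurableSpace Ω] {μ : Measure Ω} [IsFiniteMeasure μ]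
    {f : Ω → ℝ} (hf : Measurable f) {C : ℝ} (h : ∀ ω, |f ω| ≤ C) : Integrable f μ :=
  Integrable.of_bound hf.aestronglyMeasurable C (ae_of_all _ h)

lemma integral_centered_indicator {c : ℝ} (h0 : 0 ≤ c) (h1 : c ≤ 1) :
    ∫ u, ((if u < c then 1 else 0) - c) ∂uniformMeasure = 0 := by
  have hm : Measurable fun u : ℝ => (if u < c then (1 : ℝ) else 0) :=
    Measurable.ite measurableSet_Iio measurable_const measurable_const
  rw [integral_sub (integrable_of_abs_le hm (C := 1) fun u => by split_ifs <;> simp)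
    (integrable_const _)]
  have : (fun u : ℝ => (if u < c then (1 : ℝ) else 0)) = (Set.Iio c).indicator fun _ => 1 := by
    ext u; simp [Set.indicator_apply]
  rw [this, integral_indicator_const _ measurableSet_Iio]
  have h2 : uniformMeasure.real (Set.Iio c) = c := by
    rw [uniformMeasure, measureReal_restrict_apply measurableSet_Iio]
    have : Set.Iio c ∩ Set.Icc 0 1 = Set.Ico 0 c := by
      ext u
      simp only [Set.mem_inter_iff, Set.mem_Iio, Set.mem_Icc, Set.mem_Ico]
      constructor
      · rintro ⟨a, b, -⟩; exact ⟨b, a⟩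
      · rintro ⟨a, b⟩; exact ⟨b, a, by linarith⟩
    rw [this]
    simp [h0]
  simp [h2]

/-- Orthogonality of martingale differences, with resampling of coordinate j in place of
conditioning: the earlier digit does not see the new coordinate, and the later one integrates to
zero over it. -/
lemma integral_centeredDigit_mul {i j : ℕ} (hij : i < j) :
    ∫ ω, centeredDigit i ω * centeredDigit j ω ∂uniformSeq = 0 := by
  have hm : Measurable fun ω => centeredDigit i ω * centeredDigit j ω :=
    (measurable_centeredDigit i).mul (measurable_centeredDigit j)
  have hb : ∀ ω, |centeredDigit i ω * centeredDigit j ω| ≤ 1 := fun ω => by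
    rw [abs_mul]
    exact mul_le_one₀ (abs_centeredDigit_le i ω) (abs_nonneg _) (abs_centeredDigit_le j ω)
  have hp := measurePreserving_update_uniformSeq j
  rw [← hp.map_eq, integral_map hp.measurable.aemeasurable hm.aestronglyMeasurable,
    integral_prod (fun p : (ℕ → ℝ) × ℝ => centeredDigit i (Function.update p.1 j p.2) *
      centeredDigit j (Function.update p.1 j p.2))
      (integrable_of_abs_le (hm.comp hp.measurable) fun p => hb _)]
  refine integral_eq_zero_of_ae (ae_of_all _ fun ω => ?_)
  simp only [centeredDigit_update hij]
  rw [integral_const_mul]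
  have : ∀ u, centeredDigit j (Function.update ω j u) =
      (if u < randomSum j ω / Real.exp 1 then 1 else 0) - randomSum j ω / Real.exp 1 := fun u => by
    rw [centeredDigit, randomDigit, randomSum_update le_rfl, Function.update_self]
  simp only [this]
  rw [integral_centered_indicator (randomSum_div_mem j ω).1 (randomSum_div_mem j ω).2, mul_zero]
  rfl

lemma integral_sum_centeredDigit_sq_le (F : Finset ℕ) (c : ℕ → ℝ) :
    ∫ ω, (∑ n ∈ F, c n * centeredDigit n ω) ^ 2 ∂uniformSeq ≤ ∑ n ∈ F, c n ^ 2 := by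
  have hint : ∀ i j, Integrable (fun ω => c i * c j * (centeredDigit i ω * centeredDigit j ω))
      uniformSeq := fun i j => by
    refine Integrable.const_mul (integrable_of_abs_le
      ((measurable_centeredDigit i).mul (measurable_centeredDigit j)) (C := 1) fun ω => ?_) _
    rw [Pi.mul_apply, abs_mul]
    exact mul_le_one₀ (abs_centeredDigit_le i ω) (abs_nonneg _) (abs_centeredDigit_le j ω)
  have h1 : ∀ ω, (∑ n ∈ F, c n * centeredDigit n ω) ^ 2 =
      ∑ i ∈ F, ∑ j ∈ F, c i * c j * (centeredDigit i ω * centeredDigit j ω) := fun ω => by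
    rw [sq, Finset.sum_mul_sum]
    exact Finset.sum_congr rfl fun i _ => Finset.sum_congr rfl fun j _ => by ring
  simp only [h1]
  rw [integral_finsetSum _ fun i _ => integrable_finsetSum _ fun j _ => hint i j]
  refine Finset.sum_le_sum fun i hi => ?_
  rw [integral_finsetSum _ fun j _ => hint i j]
  rw [Finset.sum_eq_single i]
  · rw [integral_const_mul, ← sq]
    refine mul_le_of_le_one_right (sq_nonneg _) ?_
    have : ∫ ω, centeredDigit i ω * centeredDigit i ω ∂uniformSeq ≤ ∫ _, (1 : ℝ) ∂uniformSeq := by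
      refine integral_mono (integrable_of_abs_le
        ((measurable_centeredDigit i).mul (measurable_centeredDigit i)) (C := 1) fun ω => ?_)
        (integrable_const _) fun ω => ?_
      · rw [abs_mul]
        exact mul_le_one₀ (abs_centeredDigit_le i ω) (abs_nonneg _) (abs_centeredDigit_le i ω)
      · have := abs_centeredDigit_le i ω
        rw [← sq, sq_le_one_iff_abs_le_one]
        exact this
    simpa using this
  · intro j _ hj
    rw [integral_const_mul]
    rcases lt_or_gt_of_ne hj with h | h
    · simp only [mul_comm (centeredDigit i _)]
      rw [integral_centeredDigit_mul h, mul_zero]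
    · rw [integral_centeredDigit_mul h, mul_zero]
  · exact fun h => absurd hi h

/-- The random point of the circle given by the random factorial expansion. -/
def randomPoint (ω : ℕ → ℝ) : Circle :=
  Circle.exp (2 * Real.pi * (randomLimit ω / Real.exp 1))

lemma measurable_randomPoint : Measurable randomPoint :=
  Circle.exp.continuous.measurable.comp ((measurable_randomLimit.div_const _).const_mul _)

/-- As 1 ≤ L ≤ 2 < e, the angle L / e lies strictly between 0 and 1. This excludes an atom at 1, the
one point where the dyadic lower bound is void. -/
lemma randomPoint_ne_one (ω : ℕ → ℝ) : randomPoint ω ≠ 1 := by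
  obtain ⟨h1, h2, h3⟩ := (isDigitSum_random ω).limit_mem_Icc (tendsto_randomSum ω) 0
  have he : (2 : ℝ) < Real.exp 1 := lt_trans (by norm_num) Real.exp_one_gt_d9
  intro h
  rw [randomPoint, Circle.exp_eq_one] at h
  obtain ⟨k, hk⟩ := h
  have hpi := Real.pi_pos
  have h4 : randomLimit ω / Real.exp 1 = k := by
    have : (2 * Real.pi) ≠ 0 := by positivity
    apply mul_left_cancel₀ this
    linarith
  have h5 : 0 < randomLimit ω / Real.exp 1 := by
    have : 0 < randomLimit ω := by linarith
    positivity
  have h6 : randomLimit ω / Real.exp 1 < 1 := by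
    rw [div_lt_one (by positivity)]
    linarith
  rw [h4] at h5 h6
  have h7 : 0 < k := by exact_mod_cast h5
  have h8 : k < 1 := by exact_mod_cast h6
  omega

/-- The quadratic errors sum to at most 3/(N+1) whatever the size of F; only the martingale part
still needs cancellation. -/
lemma norm_randomPoint_pow_sub_one_le (ω : ℕ → ℝ) {N : ℕ} {F : Finset ℕ} (hF : ∀ n ∈ F, N ≤ n) :
    ‖(randomPoint ω : ℂ) ^ (∑ n ∈ F, erdosTaylor (n + 2)) - 1‖ ≤
      2 * Real.pi * (|∑ n ∈ F, 1 / ((n : ℝ) + 2) * centeredDigit n ω| + 3 / ((N : ℝ) + 1)) := by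
  set x : ℕ → ℝ := fun n => (n + 1).factorial *
    (randomLimit ω / Real.exp 1 * expPartialSum (n + 2) - randomSum n ω) with hx
  have h1 : randomPoint ω ^ (∑ n ∈ F, erdosTaylor (n + 2)) =
      Circle.exp (2 * Real.pi * ∑ n ∈ F, x n) := by
    rw [Finset.mul_sum, circle_exp_sum, ← Finset.prod_pow_eq_pow_sum]
    exact Finset.prod_congr rfl fun n _ =>
      (isDigitSum_random ω).circle_pow_erdosTaylor (randomLimit ω / Real.exp 1) n
  rw [← Circle.coe_pow, h1]
  refine (norm_circle_exp_sub_one_le _).trans ?_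
  rw [abs_mul, abs_of_pos (by positivity)]
  gcongr
  have h2 : ∑ n ∈ F, x n = ∑ n ∈ F, 1 / ((n : ℝ) + 2) * centeredDigit n ω +
      ∑ n ∈ F, (x n - centeredDigit n ω / ((n : ℝ) + 2)) := by
    rw [← Finset.sum_add_distrib]
    exact Finset.sum_congr rfl fun n _ => by ring
  rw [h2]
  refine (abs_add_le _ _).trans (add_le_add_right ?_ _)
  calc |∑ n ∈ F, (x n - centeredDigit n ω / ((n : ℝ) + 2))|
      ≤ ∑ n ∈ F, |x n - centeredDigit n ω / ((n : ℝ) + 2)| := Finset.abs_sum_le_sum_abs _ _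
    _ ≤ ∑ n ∈ F, 3 * (1 / ((n : ℝ) + 2) ^ 2) := by
        refine Finset.sum_le_sum fun n _ => ?_
        rw [mul_one_div]
        exact (isDigitSum_random ω).abs_residue_sub_le (tendsto_randomSum ω) n
    _ ≤ 3 / ((N : ℝ) + 1) := by
        rw [← Finset.mul_sum, ← mul_one_div (3 : ℝ)]
        exact mul_le_mul_of_nonneg_left (sum_inv_sq_le N F hF) (by norm_num)

/-- The law of the random point. -/
def erdosTaylorMeasure : Measure Circle := uniformSeq.map randomPoint

instance : IsProbabilityMeasure erdosTaylorMeasure :=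
  Measure.isProbabilityMeasure_map measurable_randomPoint.aemeasurable

lemma integral_pow_sub_one_sq_le {N : ℕ} {F : Finset ℕ} (hF : ∀ n ∈ F, N ≤ n) :
    ∫ z : Circle, ‖(z : ℂ) ^ (∑ n ∈ F, erdosTaylor (n + 2)) - 1‖ ^ 2 ∂erdosTaylorMeasure ≤
      80 * Real.pi ^ 2 / ((N : ℝ) + 1) := by
  have hc : Continuous fun z : Circle => (z : ℂ) := continuous_subtype_val
  set s := ∑ n ∈ F, erdosTaylor (n + 2) with hs
  have hg : Continuous fun z : Circle => ‖(z : ℂ) ^ s - 1‖ ^ 2 := by fun_prop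
  have hmap := integral_map (f := fun z : Circle => ‖(z : ℂ) ^ s - 1‖ ^ 2)
    measurable_randomPoint.aemeasurable (μ := uniformSeq) hg.aestronglyMeasurable
  rw [erdosTaylorMeasure, hmap]
  set W : (ℕ → ℝ) → ℝ := fun ω => ∑ n ∈ F, 1 / ((n : ℝ) + 2) * centeredDigit n ω with hW
  set ν : ℝ := 1 / ((N : ℝ) + 1) with hν
  have hν0 : 0 < ν := by positivity
  have hν1 : ν ≤ 1 := by
    rw [hν, div_le_one (by positivity)]
    have : (0 : ℝ) ≤ N := N.cast_nonneg
    linarith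
  have hWm : Measurable W :=
    Finset.measurable_fun_sum _ fun n _ => (measurable_centeredDigit n).const_mul _
  have hWb : ∀ ω, |W ω ^ 2| ≤ (∑ n ∈ F, 1 / ((n : ℝ) + 2)) ^ 2 := fun ω => by
    rw [abs_pow]
    refine pow_le_pow_left₀ (abs_nonneg _) ?_ 2
    refine (Finset.abs_sum_le_sum_abs _ _).trans (Finset.sum_le_sum fun n _ => ?_)
    rw [abs_mul, abs_of_nonneg (by positivity)]
    exact mul_le_of_le_one_right (by positivity) (abs_centeredDigit_le n ω)
  have hWint : Integrable (fun ω => W ω ^ 2) uniformSeq :=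
    integrable_of_abs_le (hWm.pow_const 2) hWb
  have hW2 : ∫ ω, W ω ^ 2 ∂uniformSeq ≤ ν := by
    refine (integral_sum_centeredDigit_sq_le F fun n => 1 / ((n : ℝ) + 2)).trans ?_
    refine le_trans (le_of_eq (Finset.sum_congr rfl fun n _ => ?_)) (sum_inv_sq_le N F hF)
    rw [div_pow, one_pow]
  have hpt : ∀ ω, ‖(randomPoint ω : ℂ) ^ s - 1‖ ^ 2 ≤
      8 * Real.pi ^ 2 * W ω ^ 2 + 72 * Real.pi ^ 2 * ν := by
    intro ω
    have h1 := norm_randomPoint_pow_sub_one_le ω hF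
    have h3 : 3 / ((N : ℝ) + 1) = 3 * ν := by rw [hν]; ring
    rw [h3] at h1
    have h2 := pow_le_pow_left₀ (norm_nonneg _) h1 2
    refine h2.trans ?_
    -- Here ν² ≤ ν is used; multiplying by 4π² gives the constants 8 and 72, whose sum is 80.
    have h4 : (|W ω| + 3 * ν) ^ 2 ≤ 2 * W ω ^ 2 + 18 * ν := by
      have := sq_abs (W ω)
      nlinarith [sq_nonneg (|W ω| - 3 * ν)]
    have h5 : (2 * Real.pi * (|W ω| + 3 * ν)) ^ 2 = 4 * Real.pi ^ 2 * (|W ω| + 3 * ν) ^ 2 := by ring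
    rw [h5]
    have := mul_le_mul_of_nonneg_left h4 (show 0 ≤ 4 * Real.pi ^ 2 by positivity)
    linarith
  calc ∫ ω, ‖(randomPoint ω : ℂ) ^ s - 1‖ ^ 2 ∂uniformSeq
      ≤ ∫ ω, (8 * Real.pi ^ 2 * W ω ^ 2 + 72 * Real.pi ^ 2 * ν) ∂uniformSeq := by
        refine integral_mono_of_nonneg (ae_of_all _ fun ω => by positivity)
          ((hWint.const_mul _).add (integrable_const _)) (ae_of_all _ hpt)
    _ = 8 * Real.pi ^ 2 * ∫ ω, W ω ^ 2 ∂uniformSeq + 72 * Real.pi ^ 2 * ν := by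
        rw [integral_add (hWint.const_mul _) (integrable_const _), integral_const_mul]
        simp
    _ ≤ 8 * Real.pi ^ 2 * ν + 72 * Real.pi ^ 2 * ν := by gcongr
    _ = 80 * Real.pi ^ 2 / ((N : ℝ) + 1) := by rw [hν]; ring

/-! ### The main theorem -/

lemma integral_pow_sum_erdosTaylor_sub_one_sq_le {M : ℕ} (hM : 1 ≤ M) {F : Finset ℕ}
    (hF : ∀ j ∈ F, M < j) :
    ∫ z : Circle, ‖(z : ℂ) ^ (∑ j ∈ F, erdosTaylor j) - 1‖ ^ 2 ∂erdosTaylorMeasure ≤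
      80 * Real.pi ^ 2 / M := by
  -- Reindex by j = n + 2: from j > M ≥ 1 it follows that n ≥ M - 1, with no truncation.
  have h := integral_pow_sub_one_sq_le (N := M - 1) (F := F.image (· - 2)) fun n hn => by
    obtain ⟨j, hj, rfl⟩ := Finset.mem_image.1 hn
    have := hF j hj
    omega
  have h1 : ∑ n ∈ F.image (· - 2), erdosTaylor (n + 2) = ∑ j ∈ F, erdosTaylor j := by
    rw [Finset.sum_image]
    · refine Finset.sum_congr rfl fun j hj => ?_
      have := hF j hj
      rw [Nat.sub_add_cancel (by omega)]
    · intro i hi j hj hij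
      have := hF i hi
      have := hF j hj
      simp only at hij
      omega
  rw [h1] at h
  have h2 : ((M - 1 : ℕ) : ℝ) + 1 = M := by
    rw [Nat.cast_sub hM]; push_cast; ring
  rwa [h2] at h

/-- For w ≠ 1 each dyadic block has a sum s with |w ^ s - 1| ≥ |w - 1| / 40, while the integral of
|z ^ s - 1|² tends to 0 along the blocks; so w carries no mass. -/
lemma erdosTaylorMeasure_singleton (w : Circle) : erdosTaylorMeasure {w} = 0 := by
  by_cases hw : w = 1
  · rw [erdosTaylorMeasure, Measure.map_apply measurable_randomPoint (measurableSet_singleton w)]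
    have : randomPoint ⁻¹' {w} = ∅ := by
      ext ω
      simpa [hw] using randomPoint_ne_one ω
    rw [this, measure_empty]
  · have hc : Continuous fun z : Circle => (z : ℂ) := continuous_subtype_val
    have hw0 : 0 < ‖(w : ℂ) - 1‖ :=
      norm_pos_iff.2 (sub_ne_zero.2 fun h => hw (Circle.coe_eq_one.1 h))
    have hbound : ∀ i : ℕ, erdosTaylorMeasure.real {w} * (‖(w : ℂ) - 1‖ / 40) ^ 2 ≤
        80 * Real.pi ^ 2 * (1 / 2) ^ (i + 1) := by
      intro i
      obtain ⟨G, hG, h⟩ := exists_subset_dyadicBlock w (Nat.succ_le_succ (Nat.zero_le i))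
      have h1 := integral_pow_sum_erdosTaylor_sub_one_sq_le (M := 2 ^ (i + 1)) Nat.one_le_two_pow
        (F := G) fun j hj => (Finset.mem_Ioc.1 (hG hj)).1
      set s := ∑ j ∈ G, erdosTaylor j
      have hint : Integrable (fun z : Circle => ‖(z : ℂ) ^ s - 1‖ ^ 2) erdosTaylorMeasure :=
        integrable_circle_real (by fun_prop)
      have h2 := setIntegral_le_integral (s := {w}) hint (ae_of_all _ fun z => by positivity)
      rw [integral_singleton, smul_eq_mul] at h2
      calc erdosTaylorMeasure.real {w} * (‖(w : ℂ) - 1‖ / 40) ^ 2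
          ≤ erdosTaylorMeasure.real {w} * ‖(w : ℂ) ^ s - 1‖ ^ 2 := by gcongr
        _ ≤ _ := h2.trans h1
        _ = _ := by push_cast; rw [one_div, inv_pow, div_eq_mul_inv]
    have hlim : Tendsto (fun i : ℕ => 80 * Real.pi ^ 2 * (1 / 2 : ℝ) ^ (i + 1)) atTop (𝓝 0) := by
      have := ((tendsto_pow_atTop_nhds_zero_of_lt_one (by norm_num : (0 : ℝ) ≤ 1 / 2)
        (by norm_num)).comp (tendsto_add_atTop_nat 1)).const_mul (80 * Real.pi ^ 2)
      simpa [Function.comp_def] using this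
    have h0 := ge_of_tendsto' hlim hbound
    have h1 : erdosTaylorMeasure.real {w} = 0 := by
      by_contra hne
      have : 0 < erdosTaylorMeasure.real {w} := lt_of_le_of_ne measureReal_nonneg (Ne.symm hne)
      have : 0 < erdosTaylorMeasure.real {w} * (‖(w : ℂ) - 1‖ / 40) ^ 2 := by positivity
      linarith
    exact (measureReal_eq_zero_iff).1 h1

lemma le_erdosTaylor (j : ℕ) : j ≤ erdosTaylor j := by
  induction j with
  | zero => exact Nat.zero_le _
  | succ j ih =>
    rw [erdosTaylor]
    rcases Nat.eq_zero_or_pos j with rfl | hj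
    · simp
    · nlinarith

lemma lt_of_mem_blockUnion {q : ℕ → ℕ} {l j : ℕ} (hj : j ∈ blockUnion q l) : 2 ^ q l < j := by
  obtain ⟨i, hi, hij⟩ := Finset.mem_biUnion.1 hj
  have h1 := (Finset.mem_Ioc.1 hij).1
  have h2 := Nat.pow_le_pow_right (show 0 < 2 by norm_num) (Finset.mem_Ico.1 hi).1
  omega

lemma infinite_erdosTaylorSums {q : ℕ → ℕ} (hq : StrictMono q) : (erdosTaylorSums q).Infinite := by
  refine Set.infinite_of_forall_exists_gt fun l => ⟨erdosTaylor (2 ^ (q l + 1)), ?_, ?_⟩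
  · refine Set.mem_iUnion.2 ⟨l, {2 ^ (q l + 1)}, ?_, by simp⟩
    rw [Finset.singleton_subset_iff]
    refine Finset.mem_biUnion.2 ⟨q l, Finset.mem_Ico.2 ⟨le_rfl, hq l.lt_succ_self⟩,
      Finset.mem_Ioc.2 ⟨Nat.pow_lt_pow_right (by norm_num) (Nat.lt_succ_self _), le_rfl⟩⟩
  · have h1 := le_erdosTaylor (2 ^ (q l + 1))
    have h2 : q l + 1 < 2 ^ (q l + 1) := Nat.lt_two_pow_self
    have h3 : l ≤ q l := hq.le_apply
    omega

lemma finite_subsetSums (J : Finset ℕ) : (subsetSums J).Finite := by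
  refine (J.powerset.image fun F => ∑ j ∈ F, erdosTaylor j).finite_toSet.subset ?_
  rintro - ⟨F, hF, rfl⟩
  exact Finset.mem_coe.2 (Finset.mem_image.2 ⟨F, Finset.mem_powerset.2 hF, rfl⟩)

lemma tendsto_integral_pow_sub_one_sq {q : ℕ → ℕ} (hq : StrictMono q) {n : ℕ → ℕ}
    (hn : Function.Injective n) (hnD : ∀ k, n k ∈ erdosTaylorSums q) :
    Tendsto (fun k => ∫ z : Circle, ‖(z : ℂ) ^ n k - 1‖ ^ 2 ∂erdosTaylorMeasure) atTop (𝓝 0) := by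
  rw [Metric.tendsto_atTop]
  intro ε hε
  obtain ⟨L, hL⟩ := exists_nat_gt (80 * Real.pi ^ 2 / ε)
  have hfin : (⋃ l ∈ Finset.range L, subsetSums (blockUnion q l)).Finite :=
    Set.Finite.biUnion (Finset.finite_toSet _) fun l _ => finite_subsetSums _
  -- An injective sequence leaves the finite set of sums over the first L index sets, after which
  -- each term is a sum of p_j with j > 2 ^ q_l for some l ≥ L.
  have hev : ∀ᶠ k in atTop, n k ∉ ⋃ l ∈ Finset.range L, subsetSums (blockUnion q l) := by
    rw [← Nat.cofinite_eq_atTop]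
    exact hn.tendsto_cofinite.eventually hfin.compl_mem_cofinite
  obtain ⟨K, hK⟩ := eventually_atTop.1 hev
  refine ⟨K, fun k hk => ?_⟩
  rw [Real.dist_eq, sub_zero, abs_of_nonneg (integral_nonneg fun z => by positivity)]
  obtain ⟨l, hl⟩ := Set.mem_iUnion.1 (hnD k)
  have hLl : L ≤ l := by
    by_contra hlt
    exact hK k hk (Set.mem_biUnion (Finset.mem_coe.2 (Finset.mem_range.2 (not_le.1 hlt))) hl)
  obtain ⟨F, hF, hsum⟩ := hl
  rw [hsum]
  refine (integral_pow_sum_erdosTaylor_sub_one_sq_le (M := 2 ^ q l) Nat.one_le_two_pow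
    fun j hj => lt_of_mem_blockUnion (hF hj)).trans_lt ?_
  have h1 : (L : ℝ) ≤ ((2 ^ q l : ℕ) : ℝ) := by
    exact_mod_cast (hLl.trans hq.le_apply).trans Nat.lt_two_pow_self.le
  rw [div_lt_iff₀ (by positivity)]
  rw [div_lt_iff₀ hε] at hL
  nlinarith

theorem mainTheorem10 (q : ℕ → ℕ) (hq0 : q 0 = 0) (hq : StrictMono q)
    (hN : Tendsto (fun l => q (l + 1) - q l) atTop atTop) :
    (erdosTaylorSums q).Infinite ∧
      IsRigiditySequence (Nat.nth (fun s => s ∈ erdosTaylorSums q)) ∧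
      IsBohrDense (Set.range fun k => (Nat.nth (fun s => s ∈ erdosTaylorSums q) k : ℤ)) := by
  have hinf := infinite_erdosTaylorSums hq
  have hinf' : (Set.ofPred fun s => s ∈ erdosTaylorSums q).Infinite := hinf
  refine ⟨hinf, isRigiditySequence_of_circle_measure erdosTaylorMeasure
    erdosTaylorMeasure_singleton (tendsto_integral_pow_sub_one_sq hq (Nat.nth_injective hinf')
      (Nat.nth_mem_of_infinite hinf')), ?_⟩
  have hrange : (Set.range fun k => (Nat.nth (fun s => s ∈ erdosTaylorSums q) k : ℤ)) =
      (fun n : ℕ => (n : ℤ)) '' erdosTaylorSums q := by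
    rw [← Function.comp_def (fun n : ℕ => (n : ℤ)), Set.range_comp, Nat.range_nth_of_infinite hinf']
    rfl
  rw [hrange]
  exact isBohrDense_erdosTaylorSums hq hN

end
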